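/- All links are unoriented links in $S^3$, presented by plane link diagrams; two links are equivalent if their diagrams are related by plane isotopies and Reidemeister moves. An H(2)-move is the local change of a link diagram which replaces, in a disc, a pair of parallel arcs by the other pair of parallel arcs with the same four endpoints ($)\,(\ \leftrightarrow\ \asymp$). The H(2)-unknotting number $u_2(L)$ is the minimal number of H(2)-moves, with equivalences allowed before, between and after them, that change $L$ into the unknot. For a finite sequence of integers $a_1,\dots,a_n$ ($n\ge 1$) write $[a_1,\dots,a_n]=a_1+\cfrac{1}{a_2+\cdots+\cfrac{1}{a_n}}\in\mathbb{Q}\cup\{\infty\}$, with $1/0=\infty$ and $1/\infty=0$. The rational tangle with Conway notation $(a_1,\dots,a_n)$ is the tangle with four endpoints, numbered $0,1,2,3$ from left to right on a line, obtained from a trivial tangle by making $a_n$, then $a_{n-1}$, ..., then $a_1$ half twists, where the twists $a_1,a_3,a_5,\dots$ are made on the two middle endpoints $1,2$, the twists $a_2,a_4,\dots$ are made on the two left endpoints $0,1$ with the opposite crossing sign, and the initial trivial tangle consists of two arcs joining $0$ to $1$ and $2$ to $3$ if $n$ is odd, and of two nested arcs joining $1$ to $2$ and $0$ to $3$ if $n$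 is even. Let $T_0$ be the trivial tangle of two nested arcs joining $1$ to $2$ and $0$ to $3$. Let $C(a_1,\dots,a_n)$ be the link diagram obtained from the rational tangle $(a_1,\dots,a_n)$ by joining the endpoints $0,1$ by an arc and $2,3$ by an arc outside. For coprime integers $p,q$ with $p/q=[a_1,\dots,a_n]$, the 2-bridge link $S(p,q)$ is the link with diagram $C(a_1,\dots,a_n)$. A link $K$ is a $(p,q)$-tangle unknotting number one link if, for some $a_1,\dots,a_n$ with $p/q=[a_1,\dots,a_n]$, it has a tangle decomposition $K=T_1\cup T_2$ such that $T_1$ is the rational tangle with Conway notation $(a_1,\dots,a_n)$ and $T_0\cup T_2$ is the unknot. **Corollary.** 1. If $K$ is a $(p,q)$-tangle unknotting number one link, then $u_2(K)\le u_2(S(q,p))+1$ (for every diagram $C(b_1,\dots,b_m)$ with $[b_1,\dots,b_m]=q/p$ taken as $S(q,p)$). 2. For all integers $a_1,\dots,a_n$ and $1\le i\le n$, $u_2(C(a_1,a_2,\dots,a_n))\le u_2(C(a_i,a_{i+1},\dots,a_n))+i-1$. -/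

import Mathlib

/-!
Unoriented links in the 3-sphere are presented by plane link diagrams.  A diagram is cut by
horizontal lines into slices, each of which contains exactly one local maximum, one local minimum
or one crossing, besides vertical strands.  Two diagrams present equivalent links if and only if
they are related by plane isotopies and Reidemeister moves; for sliced diagrams these are the moves
listed in `LocalMove`.
-/

namespace H2Unknotting

/-- The elementary pieces of a sliced diagram, read from bottom to top. -/
inductive Piece : Type where
  /-- a local minimum, which creates two adjacent strands -/
  | cup : Piece
  /-- a local maximum, which joins two adjacent strands -/
  | cap : Piece
  /-- a crossing in which the strand from bottom left to top right passes over -/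
  | pos : Piece
  /-- a crossing in which the strand from bottom left to top right passes under -/
  | neg : Piece

/-- Number of lower endpoints of a piece. -/
def Piece.inn : Piece → ℕ
  | .cup => 0
  | .cap => 2
  | .pos => 2
  | .neg => 2

/-- Number of upper endpoints of a piece. -/
def Piece.out : Piece → ℕ
  | .cup => 2
  | .cap => 0
  | .pos => 2
  | .neg => 2

/-- A slice: one piece, with `left` vertical strands to the left of it.  The number of vertical
strands to the right of it is determined by the total number of strands. -/
structure Slice : Type where
  piece : Piece
  left : ℕ

/-- A minimum with `i` strands on its left. -/
abbrev cup (i : ℕ) : Slice := ⟨.cup, i⟩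

/-- A maximum with `i` strands on its left. -/
abbrev cap (i : ℕ) : Slice := ⟨.cap, i⟩

/-- A crossing with `i` strands on its left, the strand from bottom left being the upper one. -/
abbrev pos (i : ℕ) : Slice := ⟨.pos, i⟩

/-- A crossing with `i` strands on its left, the strand from bottom left being the lower one. -/
abbrev neg (i : ℕ) : Slice := ⟨.neg, i⟩

/-- `Carries m w n`: the slices of `w`, stacked from bottom to top, fit together, starting with `m`
strands and ending with `n` strands. -/
def Carries : ℕ → List Slice → ℕ → Prop
  | m, [], n => m = n
  | m, s :: w, n =>
      ∃ r : ℕ, m = s.left + s.piece.inn + r ∧ Carries (s.left + s.piece.out + r) w n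

theorem Carries.append {m n k : ℕ} {u v : List Slice} (hu : Carries m u n) (hv : Carries n v k) :
    Carries m (u ++ v) k := by
  induction u generalizing m with
  | nil =>
    have h : m = n := hu
    subst h
    exact hv
  | cons s u ih =>
    obtain ⟨r, hr, h⟩ := hu
    exact ⟨r, hr, ih h⟩

/-- A diagram, in a horizontal strip, of a tangle with `m` lower and `n` upper endpoints. -/
structure Tangle (m n : ℕ) : Type where
  word : List Slice
  carries : Carries m word n

/-- A diagram of an unoriented link: a tangle diagram without endpoints. -/
abbrev LinkDiagram : Type := Tangle 0 0

/-- The union of two tangles, the second being put on top of the first. -/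
def Tangle.comp {m n k : ℕ} (S : Tangle m n) (T : Tangle n k) : Tangle m k :=
  ⟨S.word ++ T.word, S.carries.append T.carries⟩

/-- The local moves that generate equivalence of links: plane isotopies (`exchange`, the two
zigzags), strands passing across an extremum (plane isotopies near a crossing), and the
Reidemeister moves. -/
inductive LocalMove : List Slice → List Slice → Prop
  /-- two pieces that lie side by side change their heights -/
  | exchange (P Q : Piece) (i d : ℕ) :
      LocalMove [⟨P, i⟩, ⟨Q, i + P.out + d⟩] [⟨Q, i + P.inn + d⟩, ⟨P, i⟩]
  | zigzagRight (i : ℕ) : LocalMove [cup (i + 1), cap i] []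
  | zigzagLeft (i : ℕ) : LocalMove [cup i, cap (i + 1)] []
  | cupPos (i : ℕ) : LocalMove [cup i, pos (i + 1)] [cup (i + 1), neg i]
  | cupNeg (i : ℕ) : LocalMove [cup i, neg (i + 1)] [cup (i + 1), pos i]
  | capPos (i : ℕ) : LocalMove [pos (i + 1), cap i] [neg i, cap (i + 1)]
  | capNeg (i : ℕ) : LocalMove [neg (i + 1), cap i] [pos i, cap (i + 1)]
  | reidemeister1CapPos (i : ℕ) : LocalMove [pos i, cap i] [cap i]
  | reidemeister1CapNeg (i : ℕ) : LocalMove [neg i, cap i] [cap i]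
  | reidemeister1CupPos (i : ℕ) : LocalMove [cup i, pos i] [cup i]
  | reidemeister1CupNeg (i : ℕ) : LocalMove [cup i, neg i] [cup i]
  | reidemeister2PosNeg (i : ℕ) : LocalMove [pos i, neg i] []
  | reidemeister2NegPos (i : ℕ) : LocalMove [neg i, pos i] []
  | reidemeister3 (i : ℕ) :
      LocalMove [pos i, pos (i + 1), pos i] [pos (i + 1), pos i, pos (i + 1)]

/-- Two link diagrams differ by one local move, applied somewhere in the diagram. -/
def Step (D E : LinkDiagram) : Prop :=
  ∃ u x y v : List Slice, LocalMove x y ∧ D.word = u ++ x ++ v ∧ E.word = u ++ y ++ v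

/-- The diagrams present equivalent links. -/
def Equivalent : LinkDiagram → LinkDiagram → Prop := Relation.EqvGen Step

/-- `BandInsert D E`: somewhere in the diagram `D` two adjacent parallel vertical strands `| |` are
replaced by a maximum followed by a minimum (two parallel horizontal arcs), giving `E`. -/
def BandInsert (D E : LinkDiagram) : Prop :=
  ∃ (u v : List Slice) (i : ℕ), D.word = u ++ v ∧ E.word = u ++ [cap i, cup i] ++ v

/-- An H(2)-move between link diagrams: in a disc, a pair of parallel arcs is replaced by the other
pair of parallel arcs with the same four endpoints. -/
def H2Move (D E : LinkDiagram) : Prop := BandInsert D E ∨ BandInsert E D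

/-- The round diagram of the unknot. -/
def unknot : LinkDiagram := ⟨[cup 0, cap 0], 0, rfl, 0, rfl, rfl⟩

/-- `UnknotsIn n D`: the link presented by `D` can be changed into the unknot by `n` H(2)-moves;
before, between and after the moves the link may be replaced by an equivalent one. -/
inductive UnknotsIn : ℕ → LinkDiagram → Prop
  | zero {D : LinkDiagram} (h : Equivalent D unknot) : UnknotsIn 0 D
  | succ {n : ℕ} {D D' E : LinkDiagram} (h : Equivalent D D') (hm : H2Move D' E)
      (hE : UnknotsIn n E) : UnknotsIn (n + 1) D

/-- The H(2)-unknotting number: the minimal number of H(2)-moves that change the link into the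
unknot (`⊤` if there were no such number). -/
noncomputable def u2 (D : LinkDiagram) : ℕ∞ := ⨅ (n : ℕ) (_ : UnknotsIn n D), (n : ℕ∞)

/-- `|a|` half twists of the strands `i` and `i + 1`, with handedness given by the sign of `a`. -/
def twist (i : ℕ) (a : ℤ) : List Slice :=
  List.replicate a.natAbs (if 0 ≤ a then pos i else neg i)

/-- The word of the rational tangle.  With `mid = true` the outermost twists `a₁` are made on the
two middle endpoints, the next ones, with the opposite crossing sign, on the two left endpoints, and
so on alternately (so the diagram is alternating if all `aⱼ` have the same sign).  The innermost
twists `aₙ` are made on the trivial tangle that they do not leave unchanged. -/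
def rationalWord : Bool → List ℤ → List Slice
  | true, [] => [cup 0, cup 1]
  | false, [] => [cup 0, cup 0]
  | true, a :: l => rationalWord false l ++ twist 1 a
  | false, a :: l => rationalWord true l ++ twist 0 (-a)

theorem carries_twist {i m : ℕ} (a : ℤ) (h : i + 2 ≤ m) : Carries m (twist i a) m := by
  unfold twist
  induction a.natAbs with
  | zero => rfl
  | succ k ih =>
    refine ⟨m - (i + 2), ?_, ?_⟩
    · split_ifs <;> simp only [Piece.inn] <;> omega
    · have e : (if 0 ≤ a then pos i else neg i).left +
          (if 0 ≤ a then pos i else neg i).piece.out + (m - (i + 2)) = m := by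
        split_ifs <;> simp only [Piece.out] <;> omega
      rw [e]
      exact ih

theorem carries_rationalWord (b : Bool) (l : List ℤ) : Carries 0 (rationalWord b l) 4 := by
  induction l generalizing b with
  | nil =>
    cases b
    · exact ⟨0, rfl, 2, rfl, rfl⟩
    · exact ⟨0, rfl, 1, rfl, rfl⟩
  | cons a l ih =>
    cases b
    · exact (ih true).append (carries_twist _ (by norm_num))
    · exact (ih false).append (carries_twist _ (by norm_num))

/-- The rational tangle with Conway notation `(a₁, …, aₙ)`, as a tangle with four endpoints. -/
def rationalTangle (a : List ℤ) : Tangle 0 4 := ⟨rationalWord true a, carries_rationalWord true a⟩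

/-- The trivial tangle `T₀`, which the outermost twists `a₁` leave unchanged up to isotopy: one arc
joins the two middle endpoints, the other one joins the two outer endpoints. -/
def trivialTangle : Tangle 0 4 := ⟨[cup 0, cup 1], 0, rfl, 1, rfl, rfl⟩

/-- The exterior trivial tangle: one arc joins the two left endpoints, the other one the two right
endpoints. -/
def closingTangle : Tangle 4 0 := ⟨[cap 0, cap 0], 2, rfl, 0, rfl, rfl⟩

/-- The diagram `C(a₁, …, aₙ)` of a 2-bridge link. -/
def C (a : List ℤ) : LinkDiagram := (rationalTangle a).comp closingTangle

/-- Numerator and denominator of the continued fraction `a₁ + 1/(a₂ + ⋯ + 1/aₙ)`, evaluated in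
`ℚ ∪ {∞}` with `∞ = 1/0` (so that `1/0 = ∞` and `1/∞ = 0`), from `a + 1/(r/s) = (a r + s)/r`.  The
two numbers are coprime. -/
def contFrac : List ℤ → ℤ × ℤ
  | [] => (1, 0)
  | a :: l => (a * (contFrac l).1 + (contFrac l).2, (contFrac l).1)

/-- `p` and `q` are coprime and `p/q` is the continued fraction `[a₁, …, aₙ]` with `n ≥ 1`. -/
def IsContFrac (p q : ℤ) (a : List ℤ) : Prop :=
  a ≠ [] ∧ IsCoprime p q ∧ p * (contFrac a).2 = q * (contFrac a).1

/-- `L` presents the 2-bridge link `S(p, q)`. -/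
def IsTwoBridge (p q : ℤ) (L : LinkDiagram) : Prop :=
  ∃ a : List ℤ, IsContFrac p q a ∧ Equivalent L (C a)

/-- `K` presents a `(p, q)`-tangle unknotting number one link: `K = T₁ ∪ T₂`, where `T₁` is a rational
tangle with Conway notation `(a₁, …, aₙ)`, `p/q = [a₁, …, aₙ]`, and `T₀ ∪ T₂` is the unknot. -/
def IsTangleUnknottingNumberOne (p q : ℤ) (K : LinkDiagram) : Prop :=
  ∃ (a : List ℤ) (T₂ : Tangle 4 0), IsContFrac p q a ∧
    Equivalent K ((rationalTangle a).comp T₂) ∧ Equivalent (trivialTangle.comp T₂) unknot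

end H2Unknotting

namespace H2Unknotting

/-! ### Words of slices -/

/-! Both parts rest on one band move: a maximum and a minimum are inserted between the two middle
strands on top of a rational tangle.

In part 2 the new maximum absorbs the twists a₁, and the new minimum straightens against the closing
arcs. What remains is the tangle with a₁ removed and the two twisting positions interchanged, closed
by nested maxima. A half twist of the three left strands interchanges the two positions, and also
interchanges nested and parallel arcs (`iso_rationalWord_caps`). Since the two positions carry
opposite crossing signs, the outcome is the mirror image of C(a₂, …, aₙ), and mirror images need
equally many H(2)-moves (`UnknotsIn.mirror`).

In part 1 the same band splits K = T₁ ∪ T₂ into a connected sum: one summand is T₁ closed by nested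
maxima, the other is T₀ ∪ T₂, an unknot. The unknotted summand disappears (`iso_of_closure_unknot`):
the first summand is carried as a local knot on a strand throughout the isotopy from T₀ ∪ T₂ to the
round circle, and slides out of the way of each local move (`LocalMove.movable`,
`exists_tied_of_iso`). By the half twist, the summand that is left is the mirror image of the
closure of a tangle of fraction q/p.

To identify it with an arbitrary diagram C(b₁, …, bₘ) of S(q, p), one needs that rational tangles
with equal fractions are isotopic (`iso_rationalWord_intNormalForm`). Each crossing changes the
fraction by an elementary step, and every tangle reduces to a normal form read off from the
Euclidean algorithm. The delicate case is a crossing that changes the sign of the fraction; it is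
settled by the half twist, which acts on fractions as x ↦ -1/x. -/

theorem carries_nil {m n : ℕ} : Carries m [] n ↔ m = n := Iff.rfl

theorem carries_cons {m n : ℕ} {s : Slice} {w : List Slice} :
    Carries m (s :: w) n ↔
      s.left + s.piece.inn ≤ m ∧ Carries (m - s.piece.inn + s.piece.out) w n := by
  constructor
  · rintro ⟨r, rfl, h⟩
    refine ⟨by omega, ?_⟩
    convert h using 1
    omega
  · rintro ⟨h, h'⟩
    refine ⟨m - (s.left + s.piece.inn), by omega, ?_⟩
    convert h' using 1
    omega

theorem carries_append {m k : ℕ} {u v : List Slice} :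
    Carries m (u ++ v) k ↔ ∃ n, Carries m u n ∧ Carries n v k := by
  constructor
  · intro h
    induction u generalizing m with
    | nil => exact ⟨m, rfl, h⟩
    | cons s u ih =>
      obtain ⟨r, hr, h⟩ := h
      obtain ⟨n, h1, h2⟩ := ih h
      exact ⟨n, ⟨r, hr, h1⟩, h2⟩
  · rintro ⟨n, h1, h2⟩
    exact h1.append h2

theorem Carries.unique {m n n' : ℕ} {w : List Slice} (h : Carries m w n) (h' : Carries m w n') :
    n = n' := by
  induction w generalizing m with
  | nil => exact h.symm.trans h'
  | cons s w ih => exact ih (carries_cons.1 h).2 (carries_cons.1 h').2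

/-- Strands can be counted backwards from the top. This is what makes both sides of a move inside a
link diagram end at the same number of strands. -/
theorem Carries.unique_left {m m' n : ℕ} {w : List Slice} (h : Carries m w n)
    (h' : Carries m' w n) : m = m' := by
  induction w generalizing m m' with
  | nil => exact Eq.trans h (Eq.symm h')
  | cons s w ih =>
    obtain ⟨r, rfl, h⟩ := h
    obtain ⟨r', rfl, h'⟩ := h'
    have := ih h h'
    omega

/-- The same word, with `k` more strands on the left. -/
def shift (k : ℕ) (w : List Slice) : List Slice := w.map fun s => ⟨s.piece, s.left + k⟩

@[simp] theorem shift_nil (k : ℕ) : shift k [] = [] := rfl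

@[simp] theorem shift_cons (k : ℕ) (s : Slice) (w : List Slice) :
    shift k (s :: w) = ⟨s.piece, s.left + k⟩ :: shift k w := rfl

@[simp] theorem shift_append (k : ℕ) (u v : List Slice) :
    shift k (u ++ v) = shift k u ++ shift k v := List.map_append

@[simp] theorem shift_zero (w : List Slice) : shift 0 w = w := by
  simp [shift]

theorem shift_shift (k l : ℕ) (w : List Slice) : shift k (shift l w) = shift (l + k) w := by
  simp [shift, add_assoc]

theorem carries_shift {m n : ℕ} {w : List Slice} (h : Carries m w n) (k r : ℕ) :
    Carries (k + m + r) (shift k w) (k + n + r) := by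
  induction w generalizing m with
  | nil => simp_all [Carries]
  | cons s w ih =>
    obtain ⟨t, rfl, h⟩ := h
    refine ⟨t + r, by simp only; omega, ?_⟩
    have := ih h
    rwa [show k + (s.left + s.piece.out + t) + r = s.left + k + s.piece.out + (t + r) by omega]
      at this

theorem Carries.shift {m n k M N : ℕ} {w : List Slice} (h : Carries m w n)
    (hM : k + m ≤ M) (hN : N = M - m + n) : Carries M (shift k w) N := by
  have := carries_shift h k (M - (k + m))
  rwa [show k + m + (M - (k + m)) = M by omega, show k + n + (M - (k + m)) = N by omega] at this

/-! ### Equivalence of words -/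

/-- Two words, read from `m` strands on, differ by one local move. -/
def WStep (m : ℕ) (w w' : List Slice) : Prop :=
  ∃ (u x y v : List Slice) (n : ℕ), LocalMove x y ∧ w = u ++ x ++ v ∧ w' = u ++ y ++ v ∧
    Carries m (u ++ x) n ∧ Carries m (u ++ y) n

/-- The words, read from `m` strands on, are equivalent. -/
def Iso (m : ℕ) : List Slice → List Slice → Prop := Relation.EqvGen (WStep m)

@[refl] theorem Iso.refl {m : ℕ} (w : List Slice) : Iso m w w := Relation.EqvGen.refl w

@[symm] theorem Iso.symm {m : ℕ} {w w' : List Slice} (h : Iso m w w') : Iso m w' w :=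
  Relation.EqvGen.symm _ _ h

@[trans] theorem Iso.trans {m : ℕ} {w w' w'' : List Slice} (h : Iso m w w') (h' : Iso m w' w'') :
    Iso m w w'' := Relation.EqvGen.trans _ _ _ h h'

instance (m : ℕ) : Trans (Iso m) (Iso m) (Iso m) := ⟨Iso.trans⟩

theorem Iso.of_localMove {m n : ℕ} {x y : List Slice} (h : LocalMove x y) (hx : Carries m x n)
    (hy : Carries m y n) : Iso m x y :=
  Relation.EqvGen.rel _ _ ⟨[], x, y, [], n, h, by simp, by simp, hx, hy⟩

theorem Iso.map {m m' : ℕ} {f : List Slice → List Slice}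
    (hf : ∀ w w', WStep m w w' → Iso m' (f w) (f w')) {w w' : List Slice} (h : Iso m w w') :
    Iso m' (f w) (f w') := by
  induction h with
  | rel _ _ h => exact hf _ _ h
  | refl => rfl
  | symm _ _ _ ih => exact ih.symm
  | trans _ _ _ _ _ ih1 ih2 => exact ih1.trans ih2

theorem Iso.append_right {m : ℕ} {x y : List Slice} (h : Iso m x y) (v : List Slice) :
    Iso m (x ++ v) (y ++ v) := by
  refine h.map (f := (· ++ v)) ?_
  rintro _ _ ⟨u, x, y, v', n, h, rfl, rfl, h1, h2⟩
  exact Relation.EqvGen.rel _ _ ⟨u, x, y, v' ++ v, n, h, by simp, by simp, h1, h2⟩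

theorem Iso.append_left {m m' : ℕ} {x y u : List Slice} (h : Iso m' x y) (hu : Carries m u m') :
    Iso m (u ++ x) (u ++ y) := by
  refine h.map (f := (u ++ ·)) ?_
  rintro _ _ ⟨u', x, y, v', n, h, rfl, rfl, h1, h2⟩
  refine Relation.EqvGen.rel _ _ ⟨u ++ u', x, y, v', n, h, by simp, by simp, ?_, ?_⟩
  · rw [List.append_assoc]; exact hu.append h1
  · rw [List.append_assoc]; exact hu.append h2

theorem Iso.carries_iff {m : ℕ} {x y : List Slice} (h : Iso m x y) (n : ℕ) :
    Carries m x n ↔ Carries m y n := by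
  induction h with
  | rel _ _ h =>
    obtain ⟨u, x, y, v, k, -, rfl, rfl, h1, h2⟩ := h
    rw [carries_append, carries_append]
    constructor
    · rintro ⟨l, h3, h4⟩
      obtain rfl := h3.unique h1
      exact ⟨_, h2, h4⟩
    · rintro ⟨l, h3, h4⟩
      obtain rfl := h3.unique h2
      exact ⟨_, h1, h4⟩
  | refl => rfl
  | symm _ _ _ ih => exact ih.symm
  | trans _ _ _ _ _ ih1 ih2 => exact ih1.trans ih2

/-- Rewriting inside a word. -/
theorem Iso.inside {m k : ℕ} {x y : List Slice} (h : Iso k x y) (u v : List Slice)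
    (hu : Carries m u k) : Iso m (u ++ (x ++ v)) (u ++ (y ++ v)) :=
  (h.append_right v).append_left hu

/-- `Iso` preserves strand counts, so every intermediate word is itself a link diagram. -/
theorem equivalent_of_iso {D E : LinkDiagram} (h : Iso 0 D.word E.word) : Equivalent D E := by
  suffices ∀ w w', Iso 0 w w' → ∀ (hw : Carries 0 w 0) (hw' : Carries 0 w' 0),
      Equivalent ⟨w, hw⟩ ⟨w', hw'⟩ from this _ _ h D.carries E.carries
  intro w w' h
  induction h with
  | rel _ _ h =>
    obtain ⟨u, x, y, v, n, h, rfl, rfl, h1, h2⟩ := h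
    exact fun _ _ => Relation.EqvGen.rel _ _ ⟨u, x, y, v, h, rfl, rfl⟩
  | refl => exact fun _ _ => Relation.EqvGen.refl _
  | symm _ _ _ ih => exact fun h1 h2 => Relation.EqvGen.symm _ _ (ih h2 h1)
  | trans _ _ _ h _ ih1 ih2 =>
    intro h1 h2
    have h3 := (Iso.carries_iff h 0).1 h1
    exact Relation.EqvGen.trans _ _ _ (ih1 h1 h3) (ih2 h3 h2)

theorem Step.iso {D E : LinkDiagram} (h : Step D E) : WStep 0 D.word E.word := by
  obtain ⟨u, x, y, v, h, hD, hE⟩ := h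
  obtain ⟨n, h1, h2⟩ := carries_append.1 (hD ▸ D.carries)
  obtain ⟨n', h1', h2'⟩ := carries_append.1 (hE ▸ E.carries)
  obtain rfl := h2.unique_left h2'
  exact ⟨u, x, y, v, n, h, hD, hE, h1, h1'⟩

theorem Equivalent.iso {D E : LinkDiagram} (h : Equivalent D E) : Iso 0 D.word E.word := by
  induction h with
  | rel _ _ h => exact Relation.EqvGen.rel _ _ h.iso
  | refl => rfl
  | symm _ _ _ ih => exact ih.symm
  | trans _ _ _ _ _ ih1 ih2 => exact ih1.trans ih2

/-! ### Elementary equivalences -/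

/-- A crossing; the strand from bottom left is the upper one if `b` is true. -/
def crossing (b : Bool) (i : ℕ) : Slice := ⟨if b then .pos else .neg, i⟩

@[simp] theorem crossing_true (i : ℕ) : crossing true i = pos i := rfl
@[simp] theorem crossing_false (i : ℕ) : crossing false i = neg i := rfl
@[simp] theorem crossing_left (b : Bool) (i : ℕ) : (crossing b i).left = i := rfl
@[simp] theorem crossing_inn (b : Bool) (i : ℕ) : (crossing b i).piece.inn = 2 := by cases b <;> rfl
@[simp] theorem crossing_out (b : Bool) (i : ℕ) : (crossing b i).piece.out = 2 := by cases b <;> rfl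

@[simp] theorem inn_cup : Piece.cup.inn = 0 := rfl
@[simp] theorem inn_cap : Piece.cap.inn = 2 := rfl
@[simp] theorem inn_pos : Piece.pos.inn = 2 := rfl
@[simp] theorem inn_neg : Piece.neg.inn = 2 := rfl
@[simp] theorem out_cup : Piece.cup.out = 2 := rfl
@[simp] theorem out_cap : Piece.cap.out = 0 := rfl
@[simp] theorem out_pos : Piece.pos.out = 2 := rfl
@[simp] theorem out_neg : Piece.neg.out = 2 := rfl

theorem crossing_mk (b : Bool) (i j : ℕ) : (⟨(crossing b i).piece, j⟩ : Slice) = crossing b j := rfl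

theorem iso_exchange {m : ℕ} (P Q : Piece) {i j : ℕ} (d : ℕ) (hj : j = i + P.out + d)
    (hm : i + P.inn + d + Q.inn ≤ m) : Iso m [⟨P, i⟩, ⟨Q, j⟩] [⟨Q, i + P.inn + d⟩, ⟨P, i⟩] := by
  subst hj
  refine Iso.of_localMove (n := m - P.inn - Q.inn + P.out + Q.out) (.exchange P Q i d) ?_ ?_ <;>
    · simp only [carries_cons, carries_nil]
      omega

theorem iso_zigzagRight {m i : ℕ} (h : i + 1 ≤ m) : Iso m [cup (i + 1), cap i] [] := by
  refine Iso.of_localMove (n := m) (.zigzagRight i) ?_ ?_ <;>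
    (simp [carries_cons, carries_nil]; try omega)

theorem iso_zigzagLeft {m i : ℕ} (h : i + 1 ≤ m) : Iso m [cup i, cap (i + 1)] [] := by
  refine Iso.of_localMove (n := m) (.zigzagLeft i) ?_ ?_ <;>
    (simp [carries_cons, carries_nil]; try omega)

theorem iso_cup_crossing {m i : ℕ} (b : Bool) (h : i + 1 ≤ m) :
    Iso m [cup i, crossing b (i + 1)] [cup (i + 1), crossing (!b) i] := by
  cases b
  · refine Iso.of_localMove (n := m + 2) (.cupNeg i) ?_ ?_ <;>
      (simp [carries_cons, carries_nil]; try omega)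
  · refine Iso.of_localMove (n := m + 2) (.cupPos i) ?_ ?_ <;>
      (simp [carries_cons, carries_nil]; try omega)

theorem iso_crossing_cap {m i : ℕ} (b : Bool) (h : i + 3 ≤ m) :
    Iso m [crossing b (i + 1), cap i] [crossing (!b) i, cap (i + 1)] := by
  cases b
  · refine Iso.of_localMove (n := m - 2) (.capNeg i) ?_ ?_ <;>
      (simp [carries_cons, carries_nil]; try omega)
  · refine Iso.of_localMove (n := m - 2) (.capPos i) ?_ ?_ <;>
      (simp [carries_cons, carries_nil]; try omega)

theorem iso_reidemeister1_cap {m i : ℕ} (b : Bool) (h : i + 2 ≤ m) :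
    Iso m [crossing b i, cap i] [cap i] := by
  cases b
  · refine Iso.of_localMove (n := m - 2) (.reidemeister1CapNeg i) ?_ ?_ <;>
      (simp [carries_cons, carries_nil]; try omega)
  · refine Iso.of_localMove (n := m - 2) (.reidemeister1CapPos i) ?_ ?_ <;>
      (simp [carries_cons, carries_nil]; try omega)

theorem iso_reidemeister1_cup {m i : ℕ} (b : Bool) (h : i ≤ m) :
    Iso m [cup i, crossing b i] [cup i] := by
  cases b
  · refine Iso.of_localMove (n := m + 2) (.reidemeister1CupNeg i) ?_ ?_ <;>
      (simp [carries_cons, carries_nil]; try omega)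
  · refine Iso.of_localMove (n := m + 2) (.reidemeister1CupPos i) ?_ ?_ <;>
      (simp [carries_cons, carries_nil]; try omega)

theorem iso_reidemeister2 {m i : ℕ} (b : Bool) (h : i + 2 ≤ m) :
    Iso m [crossing b i, crossing (!b) i] [] := by
  cases b
  · refine Iso.of_localMove (n := m) (.reidemeister2NegPos i) ?_ ?_ <;>
      (simp [carries_cons, carries_nil]; try omega)
  · refine Iso.of_localMove (n := m) (.reidemeister2PosNeg i) ?_ ?_ <;>
      (simp [carries_cons, carries_nil]; try omega)

theorem iso_reidemeister2' {m i : ℕ} (b : Bool) (h : i + 2 ≤ m) :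
    Iso m [crossing (!b) i, crossing b i] [] := by
  simpa using iso_reidemeister2 (!b) h

theorem carries_crossing {m i : ℕ} (b : Bool) (h : i + 2 ≤ m) : Carries m [crossing b i] m := by
  simp only [carries_cons, carries_nil, crossing_left, crossing_inn, crossing_out]
  omega

theorem iso_reidemeister3_true {m i : ℕ} (h : i + 3 ≤ m) :
    Iso m [crossing true i, crossing true (i + 1), crossing true i]
      [crossing true (i + 1), crossing true i, crossing true (i + 1)] := by
  refine Iso.of_localMove (n := m) (.reidemeister3 i) ?_ ?_ <;>
    (simp [carries_cons, carries_nil]; try omega)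

/-- A strand passes over, or under, a crossing. -/
theorem iso_reidemeister3 {m i : ℕ} (b c : Bool) (h : i + 3 ≤ m) :
    Iso m [crossing c (i + 1), crossing b i, crossing b (i + 1)]
      [crossing b i, crossing b (i + 1), crossing c i] := by
  have r3 := iso_reidemeister3_true h
  have r0 := fun b => iso_reidemeister2 b (show i + 2 ≤ m by omega)
  have r1 := fun b => iso_reidemeister2 b (show (i + 1) + 2 ≤ m by omega)
  have hc : ∀ (w : List Slice), (∀ s ∈ w, s.piece.inn = 2 ∧ s.piece.out = 2 ∧ s.left ≤ i + 1) →
      Carries m w m := by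
    intro w hw
    induction w with
    | nil => rfl
    | cons s w ih =>
      obtain ⟨h1, h2, h3⟩ := hw s (by simp)
      refine carries_cons.2 ⟨by omega, ?_⟩
      rw [h1, h2, show m - 2 + 2 = m by omega]
      exact ih fun t ht => hw t (by simp [ht])
  rcases b with _ | _ <;> rcases c with _ | _
  -- The braid relation is inverted: cancelling pairs are added on the right until the positive
  -- triple appears, which is then rewritten and cancels on the left.
  · calc Iso m [neg (i + 1), neg i, neg (i + 1)]
          [neg (i + 1), neg i, neg (i + 1), pos i, neg i] :=
          ((r0 true).inside [neg (i + 1), neg i, neg (i + 1)] [] (hc _ (by simp))).symm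
      Iso m _ [neg (i + 1), neg i, neg (i + 1), pos i, pos (i + 1), neg (i + 1), neg i] :=
          ((r1 true).inside [neg (i + 1), neg i, neg (i + 1), pos i] [neg i] (hc _ (by simp))).symm
      Iso m _ [neg (i + 1), neg i, neg (i + 1), pos i, pos (i + 1), pos i, neg i, neg (i + 1),
          neg i] :=
          ((r0 true).inside [neg (i + 1), neg i, neg (i + 1), pos i, pos (i + 1)]
            [neg (i + 1), neg i] (hc _ (by simp))).symm
      Iso m _ [neg (i + 1), neg i, neg (i + 1), pos (i + 1), pos i, pos (i + 1), neg i,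
          neg (i + 1), neg i] := r3.inside [neg (i + 1), neg i, neg (i + 1)] _ (hc _ (by simp))
      Iso m _ [neg (i + 1), neg i, pos i, pos (i + 1), neg i, neg (i + 1), neg i] :=
          (r1 false).inside [neg (i + 1), neg i] _ (hc _ (by simp))
      Iso m _ [neg (i + 1), pos (i + 1), neg i, neg (i + 1), neg i] :=
          (r0 false).inside [neg (i + 1)] _ (hc _ (by simp))
      Iso m _ [neg i, neg (i + 1), neg i] := (r1 false).inside [] _ rfl
  · calc Iso m [pos (i + 1), neg i, neg (i + 1)]
          [neg i, pos i, pos (i + 1), neg i, neg (i + 1)] := ((r0 false).inside [] _ rfl).symm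
      Iso m _ [neg i, neg (i + 1), pos (i + 1), pos i, pos (i + 1), neg i, neg (i + 1)] :=
          ((r1 false).inside [neg i] _ (hc _ (by simp))).symm
      Iso m _ [neg i, neg (i + 1), pos i, pos (i + 1), pos i, neg i, neg (i + 1)] :=
          r3.symm.inside [neg i, neg (i + 1)] _ (hc _ (by simp))
      Iso m _ [neg i, neg (i + 1), pos i, pos (i + 1), neg (i + 1)] :=
          (r0 true).inside [neg i, neg (i + 1), pos i, pos (i + 1)] _ (hc _ (by simp))
      Iso m _ [neg i, neg (i + 1), pos i] :=
          (r1 true).inside [neg i, neg (i + 1), pos i] [] (hc _ (by simp))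
  · calc Iso m [neg (i + 1), pos i, pos (i + 1)]
          [neg (i + 1), pos i, pos (i + 1), pos i, neg i] :=
          ((r0 true).inside [neg (i + 1), pos i, pos (i + 1)] [] (hc _ (by simp))).symm
      Iso m _ [neg (i + 1), pos (i + 1), pos i, pos (i + 1), neg i] :=
          r3.inside [neg (i + 1)] _ (hc _ (by simp))
      Iso m _ [pos i, pos (i + 1), neg i] := (r1 false).inside [] _ rfl
  · exact r3.symm

/-! ### A strand passing across a tangle -/

theorem carries_slice {m i : ℕ} {P : Piece} (h : i + P.inn ≤ m) :
    Carries m [⟨P, i⟩] (m - P.inn + P.out) := carries_cons.2 ⟨h, rfl⟩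

theorem iso_far_left {m a c k d : ℕ} {w : List Slice} (P : Piece) (hw : Carries a w c)
    (hm : k + a + d + P.inn ≤ m) :
    Iso m (shift k w ++ [⟨P, k + c + d⟩]) ([⟨P, k + a + d⟩] ++ shift k w) := by
  induction w generalizing a m with
  | nil => obtain rfl : a = c := hw; rfl
  | cons s w ih =>
    obtain ⟨P', l⟩ := s
    obtain ⟨r, rfl, hw⟩ := hw
    simp only at hw hm ⊢
    calc Iso m (shift k (⟨P', l⟩ :: w) ++ [⟨P, k + c + d⟩])
          ([⟨P', l + k⟩] ++ ([⟨P, k + (l + P'.out + r) + d⟩] ++ shift k w)) :=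
          (ih (m := m - P'.inn + P'.out) hw (by omega)).append_left
            (carries_slice (by simp only; omega))
      Iso m _ ([⟨P, k + (l + P'.inn + r) + d⟩, ⟨P', l + k⟩] ++ shift k w) := by
          have := (iso_exchange (m := m) P' P (i := l + k) (j := k + (l + P'.out + r) + d) (r + d)
            (by omega) (by omega)).append_right (shift k w)
          rwa [show l + k + P'.inn + (r + d) = k + (l + P'.inn + r) + d by omega] at this

theorem iso_far_right {m a c k d : ℕ} {w : List Slice} (P : Piece) (hw : Carries a w c)
    (hm : k + P.inn + d + a ≤ m) :
    Iso m ([⟨P, k⟩] ++ shift (k + P.out + d) w) (shift (k + P.inn + d) w ++ [⟨P, k⟩]) := by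
  induction w generalizing a m with
  | nil => rfl
  | cons s w ih =>
    obtain ⟨P', l⟩ := s
    obtain ⟨r, rfl, hw⟩ := hw
    simp only at hw hm ⊢
    calc Iso m ([⟨P, k⟩] ++ shift (k + P.out + d) (⟨P', l⟩ :: w))
          ([⟨P', l + (k + P.inn + d)⟩, ⟨P, k⟩] ++ shift (k + P.out + d) w) := by
          have := (iso_exchange (m := m) P P' (i := k) (j := l + (k + P.out + d)) (l + d)
            (by omega) (by omega)).append_right (shift (k + P.out + d) w)
          rwa [show k + P.inn + (l + d) = l + (k + P.inn + d) by omega] at this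
      Iso m _ ([⟨P', l + (k + P.inn + d)⟩] ++ (shift (k + P.inn + d) w ++ [⟨P, k⟩])) :=
          (ih (m := m - P'.inn + P'.out) hw (by omega)).append_left (carries_slice (by omega))

/-- The strand `i` passes across the `k` strands on its right, above them if `b` is true. -/
def pass (b : Bool) (i k : ℕ) : List Slice := (List.range k).map fun t => crossing b (i + t)

theorem pass_add (b : Bool) (i k l : ℕ) : pass b i (k + l) = pass b i k ++ pass b (i + k) l := by
  simp [pass, List.range_add, add_assoc]

theorem pass_eq_shift (b : Bool) (i k : ℕ) : pass b i k = shift i (pass b 0 k) := by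
  simp only [pass, shift, List.map_map]
  refine List.map_congr_left fun t _ => ?_
  simp only [Function.comp, crossing, Slice.mk.injEq, true_and]
  omega

theorem carries_pass {m : ℕ} (b : Bool) (i k : ℕ) (h : i + k + 1 ≤ m) :
    Carries m (pass b i k) m := by
  induction k with
  | zero => rfl
  | succ k ih =>
    rw [pass_add]
    exact (ih (by omega)).append (carries_crossing b (by omega))

/-- At an extremum, pulling one of the two crossings round to the other leg makes a Reidemeister II
pair; at a crossing this is Reidemeister III. -/
theorem iso_pass_piece {m i : ℕ} (b : Bool) (P : Piece) (h : i + 1 + P.inn ≤ m) :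
    Iso m ([⟨P, i + 1⟩] ++ pass b i P.out) (pass b i P.inn ++ [⟨P, i⟩]) := by
  have r3 : ∀ c, i + 3 ≤ m → Iso m ([crossing c (i + 1)] ++ pass b i 2)
      (pass b i 2 ++ [crossing c i]) := fun c h => iso_reidemeister3 b c h
  cases P with
  | cup =>
    calc Iso m [cup (i + 1), crossing b i, crossing b (i + 1)]
          [cup i, crossing (!b) (i + 1), crossing b (i + 1)] := by
          have := (iso_cup_crossing (m := m) (!b) (i := i) (by simpa using h)).symm.inside []
            [crossing b (i + 1)] rfl
          simpa using this
      Iso m _ [cup i] := (iso_reidemeister2' (m := m + 2) b (i := i + 1)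
          (by simp at h; omega)).inside [cup i] [] (carries_slice (by simp at h ⊢; omega))
  | cap =>
    simp only [inn_cap] at h
    symm
    calc Iso m [crossing b i, crossing b (i + 1), cap i]
          [crossing b i, crossing (!b) i, cap (i + 1)] :=
          (iso_crossing_cap (m := m) b (i := i) (by omega)).inside [crossing b i] []
            (carries_crossing b (by omega))
      Iso m _ [cap (i + 1)] := (iso_reidemeister2 (m := m) b (i := i) (by omega)).inside [] _ rfl
  | pos => exact r3 true h
  | neg => exact r3 false h

/-- A strand passes above, or below, a tangle. -/
theorem iso_pass {m a c i : ℕ} {w : List Slice} (b : Bool) (hw : Carries a w c)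
    (hm : i + 1 + a ≤ m) :
    Iso m (shift (i + 1) w ++ pass b i c) (pass b i a ++ shift i w) := by
  induction w generalizing a m with
  | nil => obtain rfl : a = c := hw; simpa using Iso.refl _
  | cons s w ih =>
    obtain ⟨P, l⟩ := s
    obtain ⟨r, rfl, hw⟩ := hw
    simp only at hw hm ⊢
    have e := pass_eq_shift b i l
    have e2 := pass_eq_shift b (i + l + P.out) r
    have e3 := pass_eq_shift b (i + l + P.inn) r
    calc Iso m (shift (i + 1) (⟨P, l⟩ :: w) ++ pass b i c)
          ([⟨P, i + l + 1⟩] ++ (pass b i (l + P.out + r) ++ shift i w)) := by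
          have := (ih (m := m - P.inn + P.out) hw (by omega)).append_left (m := m)
            (u := [⟨P, i + l + 1⟩]) (carries_slice (by omega))
          rw [show i + l + 1 = l + (i + 1) by omega] at *
          exact this
      -- The passing strand meets three blocks: the strands left of the piece, those of the piece,
      -- and those right of it. The outer blocks commute with the piece, and the middle one is
      -- `iso_pass_piece`.
      Iso m _ (([⟨P, i + l + 1⟩] ++ pass b i l) ++
          (pass b (i + l) P.out ++ (pass b (i + l + P.out) r ++ shift i w))) := by
          rw [pass_add, pass_add, ← add_assoc]
          simpa using Iso.refl _
      Iso m _ ((pass b i l ++ [⟨P, i + l + 1⟩]) ++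
          (pass b (i + l) P.out ++ (pass b (i + l + P.out) r ++ shift i w))) := by
          refine Iso.append_right ?_ _
          have := (iso_far_left (m := m) (k := i) (d := 0) P
            (carries_pass (m := l + 1) b 0 l (by omega)) (by omega)).symm
          rwa [← e] at this
      Iso m _ (pass b i l ++ (([⟨P, i + l + 1⟩] ++ pass b (i + l) P.out) ++
          (pass b (i + l + P.out) r ++ shift i w))) := by
          simpa using Iso.refl _
      Iso m _ (pass b i l ++ ((pass b (i + l) P.inn ++ [⟨P, i + l⟩]) ++
          (pass b (i + l + P.out) r ++ shift i w))) :=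
          (iso_pass_piece b P (by omega)).inside _ _ (carries_pass b i l (by omega))
      Iso m _ ((pass b i l ++ pass b (i + l) P.inn) ++
          (([⟨P, i + l⟩] ++ pass b (i + l + P.out) r) ++ shift i w)) := by
          simpa using Iso.refl _
      Iso m _ ((pass b i l ++ pass b (i + l) P.inn) ++
          ((pass b (i + l + P.inn) r ++ [⟨P, i + l⟩]) ++ shift i w)) := by
          refine Iso.inside ?_ _ _ ((carries_pass b i l (by omega)).append
            (carries_pass b (i + l) P.inn (by omega)))
          have := iso_far_right (m := m) (k := i + l) (d := 0) P
            (carries_pass (m := r + 1) b 0 r (by omega)) (by omega)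
          rwa [add_zero, add_zero, ← e2, ← e3] at this
      Iso m _ (pass b i (l + P.inn + r) ++ shift i (⟨P, l⟩ :: w)) := by
          rw [pass_add, pass_add, ← add_assoc, shift_cons, add_comm l i]
          simpa using Iso.refl _

/-! ### Local knots -/

/-- A knotted arc `A`, which has two upper endpoints, is tied into the strand `i`. -/
def tie (b : Bool) (A : List Slice) (i : ℕ) : List Slice :=
  -- The arc stands to the left of the strand if `b` is true and to the right otherwise, so the two
  -- values tie it in along opposite directions.
  if b then shift i A ++ [cap (i + 1)] else shift (i + 1) A ++ [cap i]

theorem tie_eq_shift (b : Bool) (A : List Slice) (i : ℕ) : tie b A i = shift i (tie b A 0) := by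
  cases b <;> simp [tie, shift_shift, add_comm]

theorem carries_arc {A : List Slice} (hA : Carries 0 A 2) {m i : ℕ} (h : i ≤ m) :
    Carries m (shift i A) (m + 2) := hA.shift (by omega) (by omega)

theorem carries_tie {A : List Slice} (hA : Carries 0 A 2) (b : Bool) {m i : ℕ} (h : i < m) :
    Carries m (tie b A i) m := by
  cases b
  · exact (carries_arc hA h).append (carries_slice (by simp; omega))
  · exact (carries_arc hA h.le).append (carries_slice (by simp; omega))

/-- An arc moves to the left, above or below a strand. -/
theorem iso_arc_left {A : List Slice} (hA : Carries 0 A 2) (c : Bool) {m i : ℕ} (h : i + 1 ≤ m) :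
    Iso m (shift (i + 1) A ++ [crossing c i, crossing c (i + 1)]) (shift i A) :=
  iso_pass c hA h

theorem iso_arc_right {A : List Slice} (hA : Carries 0 A 2) (c : Bool) {m i : ℕ} (h : i + 1 ≤ m) :
    Iso m (shift i A ++ [crossing c (i + 1), crossing c i]) (shift (i + 1) A) := by
  have hc := carries_arc hA h
  calc Iso m (shift i A ++ [crossing c (i + 1), crossing c i])
        ((shift (i + 1) A ++ [crossing (!c) i, crossing (!c) (i + 1)]) ++
          [crossing c (i + 1), crossing c i]) := (iso_arc_left hA (!c) h).symm.append_right _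
    Iso m _ (shift (i + 1) A ++ [crossing (!c) i, crossing c i]) := by
        have := (iso_reidemeister2' (m := m + 2) (i := i + 1) c (by omega)).inside
          (shift (i + 1) A ++ [crossing (!c) i]) [crossing c i]
          (hc.append (carries_crossing _ (by omega)))
        simpa using this
    Iso m _ (shift (i + 1) A) := by
        have := (iso_reidemeister2' (m := m + 2) (i := i) c (by omega)).inside
          (shift (i + 1) A) [] hc
        simpa using this

theorem iso_arc_far_left {A : List Slice} (hA : Carries 0 A 2) (P : Piece) {m i : ℕ}
    (h : i + P.inn ≤ m) : Iso m (shift i A ++ [⟨P, i + 2⟩]) ([⟨P, i⟩] ++ shift i A) :=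
  iso_far_left (d := 0) P hA h

theorem iso_arc_far_right {A : List Slice} (hA : Carries 0 A 2) (P : Piece) {m i : ℕ}
    (h : i + P.inn ≤ m) :
    Iso m ([⟨P, i⟩] ++ shift (i + P.out) A) (shift (i + P.inn) A ++ [⟨P, i⟩]) :=
  iso_far_right (d := 0) P hA h

/-- The arc slides across the other strand on the side, above or below, that its own strand takes.
Of the two crossings so made, one cancels the old crossing by Reidemeister II and the other takes
its place. The same argument gives `iso_tie_down`. -/
theorem iso_tie_up {A : List Slice} (hA : Carries 0 A 2) (b c : Bool) {m i : ℕ} (h : i + 2 ≤ m) :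
    Iso m (tie b A i ++ [crossing c i]) ([crossing c i] ++ tie b A (i + 1)) := by
  have h1 := carries_arc hA (show i ≤ m by omega)
  have h2 := carries_arc hA (show i + 1 ≤ m by omega)
  symm
  cases b
  · calc Iso m ([crossing c i] ++ (shift (i + 2) A ++ [cap (i + 1)]))
          ((shift (i + 2) A ++ [crossing c i]) ++ [cap (i + 1)]) := by
          have := (iso_arc_far_right hA (crossing c i).piece (m := m) (i := i)
            (by simpa using h)).append_right [cap (i + 1)]
          simp only [crossing_inn, crossing_out, crossing_mk] at this
          simpa using this
      Iso m _ ((shift (i + 1) A ++ [crossing c (i + 2), crossing c (i + 1)]) ++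
          [crossing c i, cap (i + 1)]) := by
          simpa using (iso_arc_right hA c (m := m) (i := i + 1) (by omega)).symm.append_right
            [crossing c i, cap (i + 1)]
      Iso m _ ((shift (i + 1) A ++ [crossing c (i + 2), crossing c (i + 1)]) ++
          [crossing (!c) (i + 1), cap i]) := by
          have := (iso_crossing_cap (m := m + 2) (i := i) (!c) (by omega)).symm.append_left
            (h2.append ((carries_crossing (i := i + 2) c (by omega)).append
              (carries_crossing (i := i + 1) c (by omega))))
          simpa using this
      Iso m _ ((shift (i + 1) A ++ [crossing c (i + 2)]) ++ [cap i]) := by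
          have := (iso_reidemeister2 (m := m + 2) (i := i + 1) c (by omega)).inside
            (shift (i + 1) A ++ [crossing c (i + 2)]) [cap i]
            (h2.append (carries_crossing _ (by omega)))
          simpa using this
      Iso m _ ((shift (i + 1) A ++ [cap i]) ++ [crossing c i]) := by
          have := (iso_exchange (m := m + 2) .cap (crossing c i).piece (i := i) (j := i) 0
            (by simp) (by simp; omega)).symm.append_left h2
          simpa [crossing_mk] using this
  · calc Iso m ([crossing c i] ++ (shift (i + 1) A ++ [cap (i + 2)]))
          ([crossing c i] ++ ((shift i A ++ [crossing c (i + 1), crossing c i]) ++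
            [cap (i + 2)])) := (iso_arc_right hA c (by omega)).symm.inside _ _
              (carries_crossing c (by omega))
      Iso m _ ((shift i A ++ [crossing c (i + 2)]) ++
          [crossing c (i + 1), crossing c i, cap (i + 2)]) := by
          have := (iso_arc_far_left hA (crossing c i).piece (m := m) (i := i)
            (by simpa using h)).symm.append_right [crossing c (i + 1), crossing c i, cap (i + 2)]
          simpa [crossing_mk] using this
      Iso m _ ((shift i A ++ [crossing c (i + 2)]) ++
          [crossing c (i + 1), cap (i + 2), crossing c i]) := by
          have := (iso_exchange (m := m + 2) (crossing c i).piece .cap (i := i) (j := i + 2) 0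
            (by simp) (by simp; omega)).append_left (h1.append
              ((carries_crossing (i := i + 2) c (by omega)).append
              (carries_crossing (i := i + 1) c (by omega))))
          simpa [crossing_mk] using this
      Iso m _ ((shift i A ++ [crossing c (i + 2)]) ++
          [crossing (!c) (i + 2), cap (i + 1), crossing c i]) := by
          have := (iso_crossing_cap (m := m + 2) (i := i + 1) (!c) (by omega)).symm.inside
            (shift i A ++ [crossing c (i + 2)]) [crossing c i]
            (h1.append (carries_crossing (i := i + 2) c (by omega)))
          simpa using this
      Iso m _ ((shift i A ++ [cap (i + 1)]) ++ [crossing c i]) := by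
          have := (iso_reidemeister2 (m := m + 2) (i := i + 2) c (by omega)).inside
            (shift i A) [cap (i + 1), crossing c i] h1
          simpa using this

theorem iso_tie_down {A : List Slice} (hA : Carries 0 A 2) (b c : Bool) {m i : ℕ}
    (h : i + 2 ≤ m) :
    Iso m (tie b A (i + 1) ++ [crossing c i]) ([crossing c i] ++ tie b A i) := by
  have h1 := carries_arc hA (show i ≤ m by omega)
  have h2 := carries_arc hA (show i + 2 ≤ m by omega)
  cases b
  · symm
    calc Iso m ([crossing c i] ++ (shift (i + 1) A ++ [cap i]))
          ([crossing c i] ++ ((shift (i + 2) A ++ [crossing c (i + 1), crossing c (i + 2)]) ++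
            [cap i])) := (iso_arc_left hA c (by omega)).symm.inside _ _
              (carries_crossing c (by omega))
      Iso m _ ((shift (i + 2) A ++ [crossing c i]) ++
          [crossing c (i + 1), crossing c (i + 2), cap i]) := by
          have := (iso_arc_far_right hA (crossing c i).piece (m := m) (i := i)
            (by simpa using h)).append_right [crossing c (i + 1), crossing c (i + 2), cap i]
          simp only [crossing_inn, crossing_out, crossing_mk] at this
          simpa using this
      Iso m _ ((shift (i + 2) A ++ [crossing c i]) ++
          [crossing c (i + 1), cap i, crossing c i]) := by
          have := (iso_exchange (m := m + 2) .cap (crossing c i).piece (i := i) (j := i) 0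
            (by simp) (by simp; omega)).symm.append_left (h2.append
              ((carries_crossing (i := i) c (by omega)).append
              (carries_crossing (i := i + 1) c (by omega))))
          simpa [crossing_mk] using this
      Iso m _ ((shift (i + 2) A ++ [crossing c i]) ++
          [crossing (!c) i, cap (i + 1), crossing c i]) := by
          have := (iso_crossing_cap (m := m + 2) (i := i) c (by omega)).inside
            (shift (i + 2) A ++ [crossing c i]) [crossing c i]
            (h2.append (carries_crossing (i := i) c (by omega)))
          simpa using this
      Iso m _ ((shift (i + 2) A ++ [cap (i + 1)]) ++ [crossing c i]) := by
          have := (iso_reidemeister2 (m := m + 2) (i := i) c (by omega)).inside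
            (shift (i + 2) A) [cap (i + 1), crossing c i] h2
          simpa using this
  · calc Iso m ((shift (i + 1) A ++ [cap (i + 2)]) ++ [crossing c i])
          ((shift i A ++ [crossing (!c) (i + 1), crossing (!c) i]) ++
            [cap (i + 2), crossing c i]) := by
          simpa using (iso_arc_right hA (!c) (m := m) (i := i) (by omega)).symm.append_right
            [cap (i + 2), crossing c i]
      Iso m _ ((shift i A ++ [crossing (!c) (i + 1)]) ++
            [cap (i + 2), crossing (!c) i, crossing c i]) := by
          have := (iso_exchange (m := m + 2) (crossing (!c) i).piece .cap (i := i) (j := i + 2) 0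
            (by simp) (by simp; omega)).inside (shift i A ++ [crossing (!c) (i + 1)])
            [crossing c i] (h1.append (carries_crossing (i := i + 1) _ (by omega)))
          simpa [crossing_mk] using this
      Iso m _ (shift i A ++ [crossing (!c) (i + 1), cap (i + 2)]) := by
          have := (iso_reidemeister2' (m := m) (i := i) c (by omega)).append_left
            (h1.append ((carries_crossing (i := i + 1) (!c) (by omega)).append
              (carries_slice (P := .cap) (i := i + 2) (by simp; omega))))
          simpa using this
      Iso m _ ((shift i A ++ [crossing c (i + 2)]) ++ [cap (i + 1)]) := by
          have := (iso_crossing_cap (m := m + 2) (i := i + 1) c (by omega)).symm.append_left h1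
          simpa using this
      Iso m _ (([crossing c i] ++ shift i A) ++ [cap (i + 1)]) := by
          have := (iso_arc_far_left hA (crossing c i).piece (m := m) (i := i)
            (by simpa using h)).append_right [cap (i + 1)]
          simpa [crossing_mk] using this
      Iso m _ ([crossing c i] ++ (shift i A ++ [cap (i + 1)])) := by simpa using Iso.refl _

/-! ### Local knots at a minimum -/

theorem iso_cup_tie_left {A : List Slice} (hA : Carries 0 A 2) {m i : ℕ} (h : i ≤ m) :
    Iso m ([cup i] ++ tie true A i) (shift i A) := by
  calc Iso m ([cup i] ++ tie true A i) ((shift i A ++ [cup (i + 2)]) ++ [cap (i + 1)]) := by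
        simpa [tie] using
          (iso_arc_far_left hA .cup (m := m) (i := i) (by simpa using h)).symm.append_right
            [cap (i + 1)]
    Iso m _ (shift i A) := by
        simpa using (iso_zigzagRight (m := m + 2) (i := i + 1) (by omega)).append_left
          (carries_arc hA h)

theorem iso_cup_tie_right {A : List Slice} (hA : Carries 0 A 2) {m i : ℕ} (h : i ≤ m) :
    Iso m ([cup i] ++ tie false A (i + 1)) (shift i A) := by
  calc Iso m ([cup i] ++ tie false A (i + 1)) ((shift i A ++ [cup i]) ++ [cap (i + 1)]) := by
        have := (iso_arc_far_right hA .cup (m := m) (i := i) (by simpa using h)).append_right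
            [cap (i + 1)]
        simpa [tie] using this
    Iso m _ (shift i A) := by
        simpa using (iso_zigzagLeft (m := m + 2) (i := i) (by omega)).append_left
          (carries_arc hA h)

/-- An arc standing between the legs of the minimum is brought out across the left leg. -/
theorem iso_cup_arc {A : List Slice} (hA : Carries 0 A 2) (c : Bool) {m i : ℕ} (h : i ≤ m) :
    Iso m ([cup i] ++ shift (i + 1) A)
      (shift i A ++ [cup (i + 1), crossing (!c) (i + 2), crossing c i]) := by
  calc Iso m ([cup i] ++ shift (i + 1) A)
        ([cup i] ++ (shift i A ++ [crossing c (i + 1), crossing c i])) :=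
        (iso_arc_right hA c (m := m + 2) (by omega)).symm.append_left
          (carries_slice (P := .cup) (by simpa using h))
    Iso m _ ((shift i A ++ [cup (i + 2)]) ++ [crossing c (i + 1), crossing c i]) := by
        simpa using
          (iso_arc_far_left hA .cup (m := m) (i := i) (by simpa using h)).symm.append_right
            [crossing c (i + 1), crossing c i]
    Iso m _ (shift i A ++ [cup (i + 1), crossing (!c) (i + 2), crossing c i]) := by
        simpa using (iso_cup_crossing (m := m + 2) (i := i + 1) (!c) (by omega)).symm.inside
          (shift i A) [crossing c i] (carries_arc hA h)

/-- Once the arc is brought out from between the legs, the maximum removes one of the two crossings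
as a kink and the other survives. The arc with its ends crossed is the common form of both inner
positions, which lets the knot pass from one leg to the other. -/
theorem iso_cup_tie_inner_left {A : List Slice} (hA : Carries 0 A 2) (c : Bool) {m i : ℕ}
    (h : i ≤ m) :
    Iso m ([cup i] ++ tie true A (i + 1)) (shift i A ++ [crossing c i]) := by
  have h1 := carries_arc hA h
  have h2 : Carries (m + 2) [cup (i + 1)] (m + 4) := carries_slice (P := .cup) (by simp; omega)
  calc Iso m ([cup i] ++ tie true A (i + 1))
        ((shift i A ++ [cup (i + 1), crossing (!c) (i + 2), crossing c i]) ++ [cap (i + 2)]) := by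
        simpa [tie] using (iso_cup_arc hA c h).append_right [cap (i + 2)]
    Iso m _ ((shift i A ++ [cup (i + 1), crossing (!c) (i + 2)]) ++
        [cap (i + 2), crossing c i]) := by
        have := (iso_exchange (m := m + 4) (crossing c i).piece .cap (i := i) (j := i + 2) 0
          (by simp) (by simp; omega)).append_left (h1.append (h2.append
            (carries_crossing (!c) (i := i + 2) (by omega))))
        simpa [crossing_mk] using this
    Iso m _ ((shift i A ++ [cup (i + 1)]) ++ [cap (i + 2), crossing c i]) := by
        simpa using (iso_reidemeister1_cap (m := m + 4) (i := i + 2) (!c) (by omega)).inside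
          (shift i A ++ [cup (i + 1)]) [crossing c i] (h1.append h2)
    Iso m _ (shift i A ++ [crossing c i]) := by
        simpa using (iso_zigzagLeft (m := m + 2) (i := i + 1) (by omega)).inside
          (shift i A) [crossing c i] h1

theorem iso_cup_tie_inner_right {A : List Slice} (hA : Carries 0 A 2) (c : Bool) {m i : ℕ}
    (h : i ≤ m) :
    Iso m ([cup i] ++ tie false A i) (shift i A ++ [crossing c i]) := by
  have h1 := carries_arc hA h
  have h2 : Carries (m + 2) [cup (i + 1)] (m + 4) := carries_slice (P := .cup) (by simp; omega)
  calc Iso m ([cup i] ++ tie false A i)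
        ((shift i A ++ [cup (i + 1), crossing c (i + 2), crossing (!c) i]) ++ [cap i]) := by
        simpa [tie] using (iso_cup_arc hA (!c) h).append_right [cap i]
    Iso m _ ((shift i A ++ [cup (i + 1), crossing c (i + 2)]) ++ [cap i]) := by
        have := (iso_reidemeister1_cap (m := m + 4) (i := i) (!c) (by omega)).append_left
          (h1.append (h2.append (carries_crossing c (i := i + 2) (by omega))))
        simpa using this
    Iso m _ ((shift i A ++ [cup (i + 1)]) ++ [cap i, crossing c i]) := by
        have := (iso_exchange (m := m + 4) .cap (crossing c i).piece (i := i) (j := i) 0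
          (by simp) (by simp; omega)).symm.append_left (h1.append h2)
        simpa [crossing_mk] using this
    Iso m _ (shift i A ++ [crossing c i]) := by
        simpa using (iso_zigzagRight (m := m + 2) (i := i) (by omega)).inside
          (shift i A) [crossing c i] h1

/-- A local knot moves through a minimum. -/
theorem iso_cup_tie_flip {A : List Slice} (hA : Carries 0 A 2) (b : Bool) {m i : ℕ} (h : i ≤ m) :
    Iso m ([cup i] ++ tie b A i) ([cup i] ++ tie (!b) A (i + 1)) := by
  cases b
  · exact (iso_cup_tie_inner_right hA true h).trans (iso_cup_tie_inner_left hA true h).symm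
  · exact (iso_cup_tie_left hA h).trans (iso_cup_tie_right hA h).symm

/-- The strand `j` below the slice is the strand `j'` above it. -/
inductive Through : Slice → ℕ → ℕ → Prop
  | left {P : Piece} {l j : ℕ} (h : j < l) : Through ⟨P, l⟩ j j
  | right {P : Piece} {l : ℕ} (d : ℕ) : Through ⟨P, l⟩ (l + P.inn + d) (l + P.out + d)
  | up (c : Bool) (l : ℕ) : Through (crossing c l) l (l + 1)
  | down (c : Bool) (l : ℕ) : Through (crossing c l) (l + 1) l

theorem iso_tie_through {A : List Slice} (hA : Carries 0 A 2) (b : Bool) {m j j' : ℕ} {s : Slice}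
    (h : Through s j j') (hs : s.left + s.piece.inn ≤ m) (hj : j < m) :
    Iso m (tie b A j ++ [s]) ([s] ++ tie b A j') := by
  have h1 : Carries 1 (tie b A 0) 1 := carries_tie hA b (by omega)
  cases h with
  | @left P l j h =>
    simp only at hs
    rw [tie_eq_shift]
    have := iso_far_left (m := m) (k := j) (d := l - j - 1) P h1 (by omega)
    rwa [show j + 1 + (l - j - 1) = l by omega] at this
  | right d =>
    rw [tie_eq_shift, tie_eq_shift b A (_ + _ + _)]
    exact (iso_far_right _ h1 (by omega)).symm
  | up c l => exact iso_tie_up hA b c (by simpa using hs)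
  | down c l => exact iso_tie_down hA b c (by simpa using hs)

theorem exists_through_below {m j' : ℕ} {s : Slice} (hs : s.left + s.piece.inn ≤ m)
    (hj : j' < m - s.piece.inn + s.piece.out)
    (hc : s.piece = .cup → j' ≠ s.left ∧ j' ≠ s.left + 1) : ∃ j < m, Through s j j' := by
  obtain ⟨P, l⟩ := s
  simp only at hs hj hc
  rcases lt_or_ge j' l with h | h
  · exact ⟨j', by omega, .left h⟩
  rcases le_or_gt (l + P.out) j' with h' | h'
  · refine ⟨l + P.inn + (j' - l - P.out), by omega, ?_⟩
    obtain ⟨d, rfl⟩ := Nat.exists_eq_add_of_le h'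
    rw [show l + P.out + d - l - P.out = d by omega]
    exact .right d
  · have key : ∀ c : Bool, l + 2 ≤ m → j' < l + 2 → ∃ j < m, Through (crossing c l) j j' := by
      intro c h1 h2
      obtain rfl | rfl : j' = l ∨ j' = l + 1 := by omega
      · exact ⟨j' + 1, by omega, .down c _⟩
      · exact ⟨l, by omega, .up c _⟩
    cases P with
    | cup =>
      have := hc rfl
      simp only [out_cup] at h'
      omega
    | cap =>
      simp only [out_cap] at h'
      omega
    | pos => exact key true hs h'
    | neg => exact key false hs h'

theorem exists_through_above {m j : ℕ} {s : Slice} (hs : s.left + s.piece.inn ≤ m) (hj : j < m)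
    (hc : s.piece = .cap → j ≠ s.left ∧ j ≠ s.left + 1) :
    ∃ j' < m - s.piece.inn + s.piece.out, Through s j j' := by
  obtain ⟨P, l⟩ := s
  simp only at hs hc ⊢
  rcases lt_or_ge j l with h | h
  · exact ⟨j, by omega, .left h⟩
  rcases le_or_gt (l + P.inn) j with h' | h'
  · refine ⟨l + P.out + (j - l - P.inn), by omega, ?_⟩
    obtain ⟨d, rfl⟩ := Nat.exists_eq_add_of_le h'
    rw [show l + P.inn + d - l - P.inn = d by omega]
    exact .right d
  · have key : ∀ c : Bool, l + 2 ≤ m → j < l + 2 →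
        ∃ j' < m - 2 + 2, Through (crossing c l) j j' := by
      intro c h1 h2
      obtain rfl | rfl : j = l ∨ j = l + 1 := by omega
      · exact ⟨j + 1, by omega, .up c _⟩
      · exact ⟨l, by omega, .down c _⟩
    cases P with
    | cup =>
      simp only [inn_cup] at h'
      omega
    | cap =>
      have := hc rfl
      simp only [inn_cap] at h'
      omega
    | pos => exact key true hs h'
    | neg => exact key false hs h'

/-! ### Moving a local knot out of the way of a local move -/

theorem exists_iso_tie_down {A : List Slice} (hA : Carries 0 A 2) (b : Bool) {m n j : ℕ}
    {u : List Slice} (hu : Carries m u n) (hc : ∀ s ∈ u, s.piece ≠ .cup) (hj : j < n) :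
    ∃ j' < m, Iso m (u ++ tie b A j) (tie b A j' ++ u) := by
  induction u generalizing m with
  | nil =>
    obtain rfl : m = n := hu
    exact ⟨j, hj, by simpa using Iso.refl _⟩
  | cons s u ih =>
    obtain ⟨h1, h2⟩ := carries_cons.1 hu
    obtain ⟨k, hk, hi⟩ := ih h2 fun t ht => hc t (by simp [ht])
    obtain ⟨l, hl, ht⟩ := exists_through_below h1 hk fun h => absurd h (hc s (by simp))
    refine ⟨l, hl, ?_⟩
    calc Iso m (s :: u ++ tie b A j) ([s] ++ (tie b A k ++ u)) :=
          hi.append_left (u := [s]) (carries_slice h1)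
      Iso m _ (([s] ++ tie b A k) ++ u) := by simpa using Iso.refl _
      Iso m _ ((tie b A l ++ [s]) ++ u) := (iso_tie_through hA b ht h1 hl).symm.append_right u
      Iso m _ (tie b A l ++ s :: u) := by simpa using Iso.refl _

theorem exists_iso_tie_up {A : List Slice} (hA : Carries 0 A 2) (b : Bool) {m n j : ℕ}
    {v : List Slice} (hv : Carries m v n) (hc : ∀ s ∈ v, s.piece ≠ .cap) (hj : j < m) :
    ∃ j' < n, Iso m (tie b A j ++ v) (v ++ tie b A j') := by
  induction v generalizing m j with
  | nil =>
    obtain rfl : m = n := hv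
    exact ⟨j, hj, by simpa using Iso.refl _⟩
  | cons s v ih =>
    obtain ⟨h1, h2⟩ := carries_cons.1 hv
    obtain ⟨l, hl, ht⟩ := exists_through_above h1 hj fun h => absurd h (hc s (by simp))
    obtain ⟨k, hk, hi⟩ := ih h2 (fun t ht => hc t (by simp [ht])) hl
    refine ⟨k, hk, ?_⟩
    calc Iso m (tie b A j ++ s :: v) ((tie b A j ++ [s]) ++ v) := by simpa using Iso.refl _
      Iso m _ (([s] ++ tie b A l) ++ v) := (iso_tie_through hA b ht h1 hj).append_right v
      Iso m _ ([s] ++ (tie b A l ++ v)) := by simpa using Iso.refl _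
      Iso m _ ([s] ++ (v ++ tie b A k)) := hi.append_left (carries_slice h1)

/-- Local knots can be moved out of the word `x`. -/
def Movable (A x : List Slice) : Prop :=
  ∀ (m n k j : ℕ) (x₁ x₂ : List Slice) (b : Bool), x = x₁ ++ x₂ → Carries m x n →
    Carries m x₁ k → j < k →
    (∃ b' j', j' < m ∧ Iso m (x₁ ++ (tie b A j ++ x₂)) (tie b' A j' ++ x)) ∨
    ∃ b' j', j' < n ∧ Iso m (x₁ ++ (tie b A j ++ x₂)) (x ++ tie b' A j')

/-- A knot in the lower part sinks, since only minima block descent; a knot in the upper part rises,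
since only maxima block ascent. -/
theorem movable_append {A : List Slice} (hA : Carries 0 A 2) {u v : List Slice}
    (hu : ∀ s ∈ u, s.piece ≠ .cup) (hv : ∀ s ∈ v, s.piece ≠ .cap) : Movable A (u ++ v) := by
  intro m n k j x₁ x₂ b hx hn hk hj
  rcases List.append_eq_append_iff.1 hx with ⟨c, rfl, rfl⟩ | ⟨c, rfl, rfl⟩
  · right
    obtain ⟨l, h1, h2⟩ := carries_append.1 (by rwa [hx] at hn)
    obtain rfl := h1.unique hk
    obtain ⟨j', hj', hi⟩ := exists_iso_tie_up hA b h2 (fun s hs => hv s (by simp [hs])) hj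
    exact ⟨b, j', hj', by simpa using hi.append_left hk⟩
  · left
    obtain ⟨j', hj', hi⟩ := exists_iso_tie_down hA b hk (fun s hs => hu s (by simp [hs])) hj
    exact ⟨b, j', hj', by simpa using hi.append_right (c ++ v)⟩

/-- The excluded pair is a closed circle, from which a knot cannot escape. For any other minimum
below a maximum, at most one leg of the minimum is caught by the maximum, and a knot there can
change to the other leg. -/
theorem movable_pair {A : List Slice} (hA : Carries 0 A 2) {s t : Slice}
    (h : s.piece = .cup → t.piece = .cap → s.left ≠ t.left) : Movable A [s, t] := by
  by_cases hs : s.piece = .cup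
  · by_cases ht : t.piece = .cap
    · intro m n k j x₁ x₂ b hx hn hk hj
      match x₁, hx with
      | [], hx =>
        obtain rfl : m = k := hk
        simp only [List.nil_append] at hx
        subst hx
        exact .inl ⟨b, j, hj, .refl _⟩
      | [s'], hx =>
        obtain ⟨rfl, rfl⟩ : s = s' ∧ [t] = x₂ := by simpa using hx
        obtain ⟨P, i⟩ := s
        obtain ⟨Q, l⟩ := t
        simp only at hs ht h
        subst hs ht
        have hil := h rfl rfl
        have hi : i ≤ m := by simpa using (carries_cons.1 hn).1
        have hl := carries_cons.1 (carries_cons.1 hn).2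
        simp only [inn_cup, inn_cap, out_cup, out_cap, carries_nil] at hl
        obtain rfl : m + 2 = k := by simpa [carries_cons, carries_nil, hi] using hk
        have up : ∀ b j, j < m + 2 → j ≠ l → j ≠ l + 1 → ∃ j' < n,
            Iso m ([cup i] ++ (tie b A j ++ [cap l])) ([cup i, cap l] ++ tie b A j') := by
          intro b j h1 h2 h3
          obtain ⟨j', hj', ht⟩ := exists_through_above (m := m + 2) (s := cap l) (by simpa using hl.1)
            h1 fun _ => ⟨h2, h3⟩
          refine ⟨j', by simp at hj'; omega, ?_⟩
          simpa using (iso_tie_through hA b ht hl.1 h1).append_left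
            (u := [cup i]) (m := m) (carries_slice (P := .cup) (by simpa using hi))
        by_cases h1 : j = i
        · subst h1
          -- The left leg of the minimum is blocked above only when it is the right foot of the
          -- maximum; the knot then moves to the right leg, which is free.
          by_cases h2 : j = l + 1
          · obtain ⟨j', h3, h4⟩ := up (!b) (j + 1) (by omega) (by omega) (by omega)
            refine .inr ⟨!b, j', h3, .trans ?_ h4⟩
            simpa using (iso_cup_tie_flip hA b hi).append_right [cap l]
          · obtain ⟨j', h3, h4⟩ := up b j hj hil h2
            exact .inr ⟨b, j', h3, h4⟩
        by_cases h2 : j = i + 1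
        · subst h2
          -- Symmetrically, the right leg is blocked only when it is the left foot of the maximum.
          by_cases h2 : l = i + 1
          · obtain ⟨j', h3, h4⟩ := up (!b) i (by omega) (by omega) (by omega)
            refine .inr ⟨!b, j', h3, .trans ?_ h4⟩
            have := (iso_cup_tie_flip hA (!b) hi).symm.append_right [cap l]
            simpa using this
          · obtain ⟨j', h3, h4⟩ := up b (i + 1) (by omega) (by omega) (by omega)
            exact .inr ⟨b, j', h3, h4⟩
        · left
          obtain ⟨j', hj', ht⟩ := exists_through_below (m := m) (s := cup i) (j' := j)
            (by simpa using hi) (by simpa using hj) fun _ => ⟨h1, h2⟩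
          refine ⟨b, j', hj', ?_⟩
          simpa using (iso_tie_through hA b ht (by simpa using hi) hj').symm.append_right [cap l]
      | [s', t'], hx =>
        obtain ⟨rfl, rfl, rfl⟩ : s = s' ∧ t = t' ∧ x₂ = [] := by simpa using hx
        obtain rfl := hn.unique hk
        exact .inr ⟨b, j, hj, by simpa using Iso.refl _⟩
      | _ :: _ :: _ :: _, hx => simp at hx
    · exact movable_append hA (u := []) (v := [s, t]) (by simp) (by simp [hs, ht])
  · by_cases ht : t.piece = .cup
    · exact movable_append hA (u := [s]) (v := [t]) (by simp [hs]) (by simp [ht])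
    · exact movable_append hA (u := [s, t]) (v := []) (by simp [hs, ht]) (by simp)

/-- Neither side of a local move contains a whole circle; in an exchange, a minimum and a maximum
lie at least two positions apart. -/
theorem LocalMove.movable {A x y : List Slice} (hA : Carries 0 A 2) (h : LocalMove x y) :
    Movable A x ∧ Movable A y := by
  have h0 : Movable A [] := movable_append hA (u := []) (v := []) (by simp) (by simp)
  have h1 : ∀ s, s.piece ≠ .cap → Movable A [s] := fun s hs =>
    movable_append hA (u := []) (v := [s]) (by simp) (by simpa using hs)
  have h1' : ∀ s, s.piece ≠ .cup → Movable A [s] := fun s hs =>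
    movable_append hA (u := [s]) (v := []) (by simpa using hs) (by simp)
  cases h with
  | exchange P Q i d =>
    refine ⟨movable_pair hA ?_, movable_pair hA ?_⟩
    · rintro rfl rfl
      simp only [out_cup]
      omega
    · rintro rfl rfl
      simp only [inn_cap]
      omega
  | zigzagRight i => exact ⟨movable_pair hA (by simp), h0⟩
  | zigzagLeft i => exact ⟨movable_pair hA (by simp), h0⟩
  | cupPos i => exact ⟨movable_pair hA (by simp), movable_pair hA (by simp)⟩
  | cupNeg i => exact ⟨movable_pair hA (by simp), movable_pair hA (by simp)⟩
  | capPos i => exact ⟨movable_pair hA (by simp), movable_pair hA (by simp)⟩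
  | capNeg i => exact ⟨movable_pair hA (by simp), movable_pair hA (by simp)⟩
  | reidemeister1CapPos i => exact ⟨movable_pair hA (by simp), h1' _ (by simp)⟩
  | reidemeister1CapNeg i => exact ⟨movable_pair hA (by simp), h1' _ (by simp)⟩
  | reidemeister1CupPos i => exact ⟨movable_pair hA (by simp), h1 _ (by simp)⟩
  | reidemeister1CupNeg i => exact ⟨movable_pair hA (by simp), h1 _ (by simp)⟩
  | reidemeister2PosNeg i => exact ⟨movable_pair hA (by simp), h0⟩
  | reidemeister2NegPos i => exact ⟨movable_pair hA (by simp), h0⟩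
  | reidemeister3 i =>
    exact ⟨movable_append hA (u := [_, _, _]) (v := []) (by simp) (by simp),
      movable_append hA (u := [_, _, _]) (v := []) (by simp) (by simp)⟩

/-- The word `t` arises from `w`, read from `m` strands on, by tying the local knot `A` into some
strand. -/
def Tied (m : ℕ) (A w t : List Slice) : Prop :=
  ∃ (d e : List Slice) (b : Bool) (j k : ℕ), w = d ++ e ∧ Carries m d k ∧ j < k ∧
    t = d ++ (tie b A j ++ e)

/-- A knot below or above the rewritten part is unaffected. A knot inside is first moved out, after
which the unknotted part can be rewritten. -/
theorem exists_tied_of_movable {A : List Slice} (hA : Carries 0 A 2) {m l n : ℕ}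
    {u v x y t : List Slice} (hxy : Iso l x y) (hu : Carries m u l) (hx : Carries l x n)
    (hmov : Movable A x) (ht : Tied m A (u ++ (x ++ v)) t) :
    ∃ t', Tied m A (u ++ (y ++ v)) t' ∧ Iso m t t' := by
  have hy : Carries l y n := (hxy.carries_iff n).1 hx
  obtain ⟨d, e, b, j, k, hde, hd, hj, rfl⟩ := ht
  rcases List.append_eq_append_iff.1 hde with ⟨c, rfl, hc⟩ | ⟨c, rfl, rfl⟩
  · obtain ⟨l', h1, h2⟩ := carries_append.1 hd
    obtain rfl := h1.unique hu
    rcases List.append_eq_append_iff.1 hc with ⟨c', rfl, rfl⟩ | ⟨c', rfl, rfl⟩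
    · refine ⟨(u ++ (y ++ c')) ++ (tie b A j ++ e), ⟨u ++ (y ++ c'), e, b, j, k, by simp,
        ?_, hj, rfl⟩, ?_⟩
      · exact ((hxy.inside u c' hu).carries_iff k).1 hd
      · simpa using hxy.inside u (c' ++ (tie b A j ++ e)) hu
    · rcases hmov _ _ _ _ _ _ b rfl hx h2 hj with ⟨b', j', hj', hi⟩ | ⟨b', j', hj', hi⟩
      · refine ⟨u ++ (tie b' A j' ++ (y ++ v)), ⟨u, y ++ v, b', j', _, by simp, hu, hj', rfl⟩, ?_⟩
        calc Iso m _ (u ++ ((c ++ (tie b A j ++ c')) ++ v)) := by simpa using Iso.refl _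
          Iso m _ (u ++ ((tie b' A j' ++ (c ++ c')) ++ v)) := hi.inside u v hu
          Iso m _ ((u ++ tie b' A j') ++ ((c ++ c') ++ v)) := by simpa using Iso.refl _
          Iso m _ ((u ++ tie b' A j') ++ (y ++ v)) :=
              hxy.inside _ v (hu.append (carries_tie hA b' hj'))
          Iso m _ (u ++ (tie b' A j' ++ (y ++ v))) := by simpa using Iso.refl _
      · refine ⟨(u ++ y) ++ (tie b' A j' ++ v), ⟨u ++ y, v, b', j', _, by simp, hu.append hy, hj',
          rfl⟩, ?_⟩
        calc Iso m _ (u ++ ((c ++ (tie b A j ++ c')) ++ v)) := by simpa using Iso.refl _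
          Iso m _ (u ++ (((c ++ c') ++ tie b' A j') ++ v)) := hi.inside u v hu
          Iso m _ (u ++ ((c ++ c') ++ (tie b' A j' ++ v))) := by simpa using Iso.refl _
          Iso m _ (u ++ (y ++ (tie b' A j' ++ v))) := hxy.inside _ _ hu
          Iso m _ ((u ++ y) ++ (tie b' A j' ++ v)) := by simpa using Iso.refl _
  · obtain ⟨k', h1, h2⟩ := carries_append.1 hu
    obtain rfl := h1.unique hd
    refine ⟨d ++ (tie b A j ++ (c ++ (y ++ v))), ⟨d, c ++ (y ++ v), b, j, _, by simp, hd, hj,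
      rfl⟩, ?_⟩
    simpa using hxy.inside (d ++ (tie b A j ++ c)) v (hd.append ((carries_tie hA b hj).append h2))

/-- The knot is carried along step by step, though its final strand and direction are not
controlled. Both directions are proved together because the generated equivalence relation includes
inverses of moves. -/
theorem exists_tied_of_iso {A : List Slice} (hA : Carries 0 A 2) {m : ℕ} {w w' : List Slice}
    (h : Iso m w w') :
    (∀ t, Tied m A w t → ∃ t', Tied m A w' t' ∧ Iso m t t') ∧
    ∀ t, Tied m A w' t → ∃ t', Tied m A w t' ∧ Iso m t t' := by
  induction h with
  | rel _ _ h =>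
    obtain ⟨u, x, y, v, n, hxy, rfl, rfl, h1, h2⟩ := h
    obtain ⟨l, hu, hx⟩ := carries_append.1 h1
    obtain ⟨l', hu', hy⟩ := carries_append.1 h2
    obtain rfl := hu.unique hu'
    have hi : Iso l x y := .of_localMove hxy hx hy
    rw [List.append_assoc, List.append_assoc]
    exact ⟨fun t => exists_tied_of_movable hA hi hu hx (hxy.movable hA).1,
      fun t => exists_tied_of_movable hA hi.symm hu hy (hxy.movable hA).2⟩
  | refl => exact ⟨fun t ht => ⟨t, ht, .refl _⟩, fun t ht => ⟨t, ht, .refl _⟩⟩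
  | symm _ _ _ ih => exact ih.symm
  | trans _ _ _ _ _ ih1 ih2 =>
    constructor
    · intro t ht
      obtain ⟨t1, h1, h1'⟩ := ih1.1 t ht
      obtain ⟨t2, h2, h2'⟩ := ih2.1 t1 h1
      exact ⟨t2, h2, h1'.trans h2'⟩
    · intro t ht
      obtain ⟨t1, h1, h1'⟩ := ih2.2 t ht
      obtain ⟨t2, h2, h2'⟩ := ih1.2 t1 h1
      exact ⟨t2, h2, h1'.trans h2'⟩

/-- On the round circle there are two strands and two directions for the knot. The two outer
placements give the closed arc at once; the two inner ones leave a kink under the maximum, removed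
by Reidemeister I. -/
theorem iso_of_tied_unknot {A t : List Slice} (hA : Carries 0 A 2)
    (h : Tied 0 A [cup 0, cap 0] t) : Iso 0 t (A ++ [cap 0]) := by
  obtain ⟨d, e, b, j, k, hde, hd, hj, rfl⟩ := h
  have r1 : Iso 0 ((A ++ [crossing true 0]) ++ [cap 0]) (A ++ [cap 0]) := by
    simpa using (iso_reidemeister1_cap (m := 2) (i := 0) true le_rfl).append_left hA
  match d, hde with
  | [], _ =>
    obtain rfl : 0 = k := hd
    omega
  | [s], hde =>
    obtain ⟨rfl, rfl⟩ : cup 0 = s ∧ [cap 0] = e := by simpa using hde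
    obtain rfl : 2 = k := by simpa [carries_cons, carries_nil] using hd
    obtain rfl | rfl : j = 0 ∨ j = 1 := by omega
    · cases b
      · refine .trans ?_ r1
        simpa using (iso_cup_tie_inner_right hA true (m := 0) (i := 0) le_rfl).append_right [cap 0]
      · simpa using (iso_cup_tie_left hA (m := 0) (i := 0) le_rfl).append_right [cap 0]
    · cases b
      · simpa using (iso_cup_tie_right hA (m := 0) (i := 0) le_rfl).append_right [cap 0]
      · refine .trans ?_ r1
        simpa using (iso_cup_tie_inner_left hA true (m := 0) (i := 0) le_rfl).append_right [cap 0]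
  | [s, s'], hde =>
    obtain ⟨rfl, rfl, rfl⟩ : cup 0 = s ∧ cap 0 = s' ∧ e = [] := by simpa using hde
    obtain rfl : 0 = k := by simpa [carries_cons, carries_nil] using hd
    omega
  | _ :: _ :: _ :: _, hde => simp at hde

/-- A connected sum with the unknot does not change a link. -/
theorem iso_of_closure_unknot {A B : List Slice} (hA : Carries 0 A 2)
    (h : Iso 0 ([cup 0] ++ B) [cup 0, cap 0]) : Iso 0 (A ++ B) (A ++ [cap 0]) := by
  -- Tying `A` into the left leg of the bottom minimum replaces that minimum by `A`, so the knotted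
  -- word is `A ++ B` up to isotopy.
  obtain ⟨t, ht, hi⟩ := (exists_tied_of_iso hA h).1 ([cup 0] ++ (tie true A 0 ++ B))
    ⟨[cup 0], B, true, 0, 2, rfl, carries_slice (P := .cup) le_rfl, by omega, rfl⟩
  refine .trans ?_ (hi.trans (iso_of_tied_unknot hA ht))
  simpa using (iso_cup_tie_left hA (m := 0) (i := 0) le_rfl).symm.append_right B

/-! ### Mirror images -/

/-- The piece with over- and undercrossings exchanged. -/
def Piece.mirror : Piece → Piece
  | .cup => .cup
  | .cap => .cap
  | .pos => .neg
  | .neg => .pos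

@[simp] theorem Piece.inn_mirror (P : Piece) : P.mirror.inn = P.inn := by cases P <;> rfl
@[simp] theorem Piece.out_mirror (P : Piece) : P.mirror.out = P.out := by cases P <;> rfl

/-- The word with over- and undercrossings exchanged. -/
def mirrorWord (w : List Slice) : List Slice := w.map fun s => ⟨s.piece.mirror, s.left⟩

@[simp] theorem mirror_nil : mirrorWord [] = [] := rfl

@[simp] theorem mirror_cons (s : Slice) (w : List Slice) :
    mirrorWord (s :: w) = ⟨s.piece.mirror, s.left⟩ :: mirrorWord w := rfl

@[simp] theorem mirror_append (u v : List Slice) : mirrorWord (u ++ v) = mirrorWord u ++ mirrorWord v :=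
  List.map_append

@[simp] theorem mirror_cup : Piece.cup.mirror = .cup := rfl
@[simp] theorem mirror_cap : Piece.cap.mirror = .cap := rfl
@[simp] theorem mirror_pos : Piece.pos.mirror = .neg := rfl
@[simp] theorem mirror_neg : Piece.neg.mirror = .pos := rfl

theorem Carries.mirror {m n : ℕ} {w : List Slice} (h : Carries m w n) :
    Carries m (mirrorWord w) n := by
  induction w generalizing m with
  | nil => exact h
  | cons s w ih =>
    obtain ⟨r, hr, h⟩ := h
    refine ⟨r, by simpa using hr, ?_⟩
    rw [← Piece.out_mirror] at h
    exact ih h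

theorem iso_mirror_of_localMove {m n : ℕ} {x y : List Slice} (h : LocalMove x y)
    (hx : Carries m x n) (hy : Carries m y n) : Iso m (mirrorWord x) (mirrorWord y) := by
  have h1 := hx.mirror
  have h2 := hy.mirror
  cases h with
  | exchange P Q i d =>
    refine .of_localMove ?_ h1 h2
    simpa using LocalMove.exchange P.mirror Q.mirror i d
  | zigzagRight i => exact .of_localMove (.zigzagRight i) h1 h2
  | zigzagLeft i => exact .of_localMove (.zigzagLeft i) h1 h2
  | cupPos i => exact .of_localMove (.cupNeg i) h1 h2
  | cupNeg i => exact .of_localMove (.cupPos i) h1 h2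
  | capPos i => exact .of_localMove (.capNeg i) h1 h2
  | capNeg i => exact .of_localMove (.capPos i) h1 h2
  | reidemeister1CapPos i => exact .of_localMove (.reidemeister1CapNeg i) h1 h2
  | reidemeister1CapNeg i => exact .of_localMove (.reidemeister1CapPos i) h1 h2
  | reidemeister1CupPos i => exact .of_localMove (.reidemeister1CupNeg i) h1 h2
  | reidemeister1CupNeg i => exact .of_localMove (.reidemeister1CupPos i) h1 h2
  | reidemeister2PosNeg i => exact .of_localMove (.reidemeister2NegPos i) h1 h2
  | reidemeister2NegPos i => exact .of_localMove (.reidemeister2PosNeg i) h1 h2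
  | reidemeister3 i =>
    -- Only the positive Reidemeister III move is a generator; its mirror image was derived from it.
    have := (carries_cons.1 hy).1
    exact (iso_reidemeister3 false false this).symm

theorem Iso.mirror {m : ℕ} {w w' : List Slice} (h : Iso m w w') :
    Iso m (mirrorWord w) (mirrorWord w') := by
  refine h.map ?_
  rintro _ _ ⟨u, x, y, v, n, hxy, rfl, rfl, h1, h2⟩
  obtain ⟨l, hu, hx⟩ := carries_append.1 h1
  obtain ⟨l', hu', hy⟩ := carries_append.1 h2
  obtain rfl := hu.unique hu'
  simpa using (iso_mirror_of_localMove hxy hx hy).inside _ (mirrorWord v) hu.mirror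

/-- The mirror image of a link diagram. -/
def mirrorDiagram (D : LinkDiagram) : LinkDiagram := ⟨mirrorWord D.word, D.carries.mirror⟩

theorem Equivalent.mirror {D E : LinkDiagram} (h : Equivalent D E) :
    Equivalent (mirrorDiagram D) (mirrorDiagram E) :=
  equivalent_of_iso h.iso.mirror

theorem BandInsert.mirror {D E : LinkDiagram} (h : BandInsert D E) :
    BandInsert (mirrorDiagram D) (mirrorDiagram E) := by
  obtain ⟨u, v, i, hD, hE⟩ := h
  refine ⟨mirrorWord u, mirrorWord v, i, ?_, ?_⟩
  · simp [mirrorDiagram, hD]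
  · simp [mirrorDiagram, hE]

/-- Needed because the band moves below lead to mirror images of 2-bridge diagrams; bands and the
round circle contain no crossings. -/
theorem UnknotsIn.mirror {n : ℕ} {D : LinkDiagram} (h : UnknotsIn n D) :
    UnknotsIn n (mirrorDiagram D) := by
  induction h with
  | zero h => exact .zero h.mirror
  | succ h hm _ ih => exact .succ h.mirror (hm.imp BandInsert.mirror BandInsert.mirror) ih

/-! ### Bounds on the H(2)-unknotting number -/

theorem UnknotsIn.of_equivalent {n : ℕ} {D E : LinkDiagram} (hE : UnknotsIn n E)
    (h : Equivalent D E) : UnknotsIn n D := by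
  cases hE with
  | zero h' => exact .zero (.trans _ _ _ h h')
  | succ h' hm h'' => exact .succ (.trans _ _ _ h h') hm h''

theorem u2_le_add {K L : LinkDiagram} (k : ℕ) (h : ∀ n, UnknotsIn n L → UnknotsIn (n + k) K) :
    u2 K ≤ u2 L + k := by
  by_cases hL : ∃ n, UnknotsIn n L
  · classical
    have e : u2 L = (Nat.find hL : ℕ∞) := by
      refine le_antisymm (iInf₂_le (Nat.find hL) (Nat.find_spec hL)) (le_iInf₂ fun n hn => ?_)
      exact_mod_cast Nat.find_min' hL hn
    rw [e]
    refine (iInf₂_le (Nat.find hL + k) (h _ (Nat.find_spec hL))).trans ?_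
    push_cast
    exact le_rfl
  · have e : u2 L = ⊤ := by
      refine top_le_iff.1 (le_iInf₂ fun n hn => absurd ⟨n, hn⟩ hL)
    simp [e]

/-! ### The half twist of three strands -/

/-- A half twist of the three left strands. -/
def halfTwist (b : Bool) : List Slice := [crossing b 0, crossing b 1, crossing b 0]

theorem iso_crossing_comm {m i : ℕ} (b c : Bool) (h : i + 2 ≤ m) :
    Iso m [crossing b i, crossing c i] [crossing c i, crossing b i] := by
  obtain rfl | rfl : b = c ∨ b = !c := by cases b <;> cases c <;> simp
  · rfl
  · exact (iso_reidemeister2' c h).trans (iso_reidemeister2 c h).symm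

/-- A strand passes to the left, above or below a crossing. -/
theorem iso_reidemeister3_left {m i : ℕ} (b c : Bool) (h : i + 3 ≤ m) :
    Iso m [crossing c i, crossing b (i + 1), crossing b i]
      [crossing b (i + 1), crossing b i, crossing c (i + 1)] := by
  have c0 : ∀ b, Carries m [crossing b i] m := fun b => carries_crossing b (by omega)
  have c1 : ∀ b, Carries m [crossing b (i + 1)] m := fun b => carries_crossing b (by omega)
  calc Iso m [crossing c i, crossing b (i + 1), crossing b i]
        [crossing b (i + 1), crossing (!b) (i + 1), crossing c i, crossing b (i + 1),
          crossing b i] := (iso_reidemeister2 b (by omega)).symm.inside [] _ rfl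
    Iso m _ [crossing b (i + 1), crossing b i, crossing (!b) i, crossing (!b) (i + 1),
        crossing c i, crossing b (i + 1), crossing b i] :=
        (iso_reidemeister2 b (by omega)).symm.inside [crossing b (i + 1)] _ (c1 b)
    Iso m _ [crossing b (i + 1), crossing b i, crossing c (i + 1), crossing (!b) i,
        crossing (!b) (i + 1), crossing b (i + 1), crossing b i] :=
        (iso_reidemeister3 (!b) c h).symm.inside [crossing b (i + 1), crossing b i] _
          ((c1 b).append (c0 b))
    Iso m _ [crossing b (i + 1), crossing b i, crossing c (i + 1), crossing (!b) i,
        crossing b i] :=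
        (iso_reidemeister2' b (by omega)).inside
          [crossing b (i + 1), crossing b i, crossing c (i + 1), crossing (!b) i] [crossing b i]
          ((c1 b).append ((c0 b).append ((c1 c).append (c0 (!b)))))
    Iso m _ [crossing b (i + 1), crossing b i, crossing c (i + 1)] :=
        (iso_reidemeister2' b (by omega)).inside
          [crossing b (i + 1), crossing b i, crossing c (i + 1)] []
          ((c1 b).append ((c0 b).append (c1 c)))

/-- The half twist is the Garside element of the braid group on three strands, and conjugation by it
interchanges the two generators. -/
theorem iso_crossing_one_halfTwist (b c : Bool) :
    Iso 4 ([crossing c 1] ++ halfTwist b) (halfTwist b ++ [crossing c 0]) := by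
  calc Iso 4 [crossing c 1, crossing b 0, crossing b 1, crossing b 0]
        [crossing b 0, crossing b 1, crossing c 0, crossing b 0] :=
        (iso_reidemeister3 b c (m := 4) (i := 0) (by omega)).append_right [crossing b 0]
    Iso 4 _ [crossing b 0, crossing b 1, crossing b 0, crossing c 0] :=
        (iso_crossing_comm c b (by omega)).append_left
          ((carries_crossing b (i := 0) (by omega)).append
            (carries_crossing b (i := 1) (by omega)))

theorem iso_crossing_zero_halfTwist (b c : Bool) :
    Iso 4 ([crossing c 0] ++ halfTwist b) (halfTwist b ++ [crossing c 1]) := by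
  calc Iso 4 [crossing c 0, crossing b 0, crossing b 1, crossing b 0]
        [crossing b 0, crossing c 0, crossing b 1, crossing b 0] :=
        (iso_crossing_comm c b (by omega)).append_right [crossing b 1, crossing b 0]
    Iso 4 _ [crossing b 0, crossing b 1, crossing b 0, crossing c 1] :=
        (iso_reidemeister3_left b c (m := 4) (i := 0) (by omega)).append_left
          (carries_crossing b (i := 0) (by omega))

/-- The trivial tangle of two nested arcs. -/
abbrev nestedCups : List Slice := [cup 0, cup 1]

/-- The trivial tangle of two arcs that lie side by side. -/
abbrev parallelCups : List Slice := [cup 0, cup 0]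

theorem carries_cups {i : ℕ} (h : i ≤ 2) : Carries 0 [cup 0, cup i] 4 := by
  simp [carries_cons, carries_nil, h]

theorem iso_parallelCups_halfTwist (b : Bool) :
    Iso 0 (parallelCups ++ halfTwist b) nestedCups := by
  have c0 : Carries 0 [cup 0] 2 := carries_slice (P := .cup) le_rfl
  calc Iso 0 [cup 0, cup 0, crossing b 0, crossing b 1, crossing b 0]
        [cup 0, cup 0, crossing b 1, crossing b 0] :=
        (iso_reidemeister1_cup b (by omega)).inside [cup 0] [crossing b 1, crossing b 0] c0
    Iso 0 _ [cup 0, cup 1, crossing (!b) 0, crossing b 0] :=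
        (iso_cup_crossing b (m := 2) (i := 0) (by omega)).inside [cup 0] [crossing b 0] c0
    Iso 0 _ [cup 0, cup 1] :=
        (iso_reidemeister2' b (m := 4) (by omega)).append_left (carries_cups (i := 1) (by omega))

/-- Both sides are the tangle of fraction 1 or -1, built from either trivial tangle. -/
theorem iso_nestedCups_crossing (b : Bool) :
    Iso 0 (nestedCups ++ [crossing b 0]) (parallelCups ++ [crossing (!b) 1]) := by
  have := (iso_cup_crossing (!b) (m := 2) (i := 0) (by omega)).symm.append_left (u := [cup 0])
    (carries_slice (m := 0) (P := .cup) le_rfl)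
  simpa using this

theorem iso_nestedCups_halfTwist (b : Bool) :
    Iso 0 (nestedCups ++ halfTwist b) parallelCups := by
  calc Iso 0 [cup 0, cup 1, crossing b 0, crossing b 1, crossing b 0]
        [cup 0, cup 0, crossing (!b) 1, crossing b 1, crossing b 0] :=
        (iso_nestedCups_crossing b).append_right [crossing b 1, crossing b 0]
    Iso 0 _ [cup 0, cup 0, crossing b 0] :=
        (iso_reidemeister2' b (m := 4) (by omega)).inside [cup 0, cup 0] [crossing b 0]
          (carries_cups (by omega))
    Iso 0 _ [cup 0, cup 0] :=
        (iso_reidemeister1_cup b (by omega)).append_left (u := [cup 0])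
          (carries_slice (m := 0) (P := .cup) le_rfl)

theorem iso_halfTwist_caps (b : Bool) : Iso 4 (halfTwist b ++ [cap 0, cap 0]) [cap 1, cap 0] := by
  have c0 : Carries 4 [crossing b 0] 4 := carries_crossing b (by omega)
  calc Iso 4 [crossing b 0, crossing b 1, crossing b 0, cap 0, cap 0]
        [crossing b 0, crossing b 1, cap 0, cap 0] :=
        (iso_reidemeister1_cap b (by omega)).inside [crossing b 0, crossing b 1] [cap 0]
          (c0.append (carries_crossing b (by omega)))
    Iso 4 _ [crossing b 0, crossing (!b) 0, cap 1, cap 0] :=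
        (iso_crossing_cap b (m := 4) (i := 0) (by omega)).inside [crossing b 0] [cap 0] c0
    Iso 4 _ [cap 1, cap 0] := (iso_reidemeister2 b (by omega)).inside [] _ rfl

/-! ### Rational tangles -/

theorem twist_eq (i : ℕ) (a : ℤ) :
    twist i a = List.replicate a.natAbs (crossing (decide (0 ≤ a)) i) := by
  unfold twist crossing
  by_cases h : 0 ≤ a <;> simp [h]

theorem mirror_twist (i : ℕ) (a : ℤ) : mirrorWord (twist i a) = twist i (-a) := by
  unfold twist mirrorWord
  rcases lt_trichotomy a 0 with h | rfl | h
  · simp [h.le, not_le.2 h]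
  · simp
  · simp [h.le, not_le.2 h]

theorem iso_replicate_append {m : ℕ} {s s' : Slice} {w : List Slice} (hs : Carries m [s] m)
    (h : Iso m ([s] ++ w) (w ++ [s'])) (n : ℕ) :
    Iso m (List.replicate n s ++ w) (w ++ List.replicate n s') := by
  induction n with
  | zero => simpa using Iso.refl w
  | succ n ih =>
    calc Iso m (List.replicate (n + 1) s ++ w) ([s] ++ (List.replicate n s ++ w)) := by
          simpa [List.replicate_succ] using Iso.refl _
      Iso m _ ([s] ++ (w ++ List.replicate n s')) := ih.append_left hs
      Iso m _ (([s] ++ w) ++ List.replicate n s') := by simpa using Iso.refl _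
      Iso m _ ((w ++ [s']) ++ List.replicate n s') := h.append_right _
      Iso m _ (w ++ List.replicate (n + 1) s') := by
          simpa [List.replicate_succ] using Iso.refl _

theorem iso_twist_one_halfTwist (b : Bool) (a : ℤ) :
    Iso 4 (twist 1 a ++ halfTwist b) (halfTwist b ++ twist 0 a) := by
  rw [twist_eq, twist_eq]
  exact iso_replicate_append (carries_crossing _ (by omega)) (iso_crossing_one_halfTwist b _) _

theorem iso_twist_zero_halfTwist (b : Bool) (a : ℤ) :
    Iso 4 (twist 0 a ++ halfTwist b) (halfTwist b ++ twist 1 a) := by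
  rw [twist_eq, twist_eq]
  exact iso_replicate_append (carries_crossing _ (by omega)) (iso_crossing_zero_halfTwist b _) _

theorem iso_twist_cap {m i : ℕ} (a : ℤ) (h : i + 2 ≤ m) :
    Iso m (twist i a ++ [cap i]) [cap i] := by
  rw [twist_eq]
  induction a.natAbs with
  | zero => rfl
  | succ n ih =>
    refine .trans (ih.append_left (u := [crossing _ i]) (carries_crossing _ h)) ?_
    exact iso_reidemeister1_cap _ h

/-- Rotating a rational tangle. -/
theorem iso_rationalWord_halfTwist (b c : Bool) (l : List ℤ) :
    Iso 0 (rationalWord c l ++ halfTwist b) (mirrorWord (rationalWord (!c) l)) := by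
  induction l generalizing c with
  | nil =>
    cases c
    · exact iso_parallelCups_halfTwist b
    · exact iso_nestedCups_halfTwist b
  | cons a l ih =>
    cases c
    · calc Iso 0 ((rationalWord true l ++ twist 0 (-a)) ++ halfTwist b)
            (rationalWord true l ++ (twist 0 (-a) ++ halfTwist b)) := by simpa using Iso.refl _
        Iso 0 _ (rationalWord true l ++ (halfTwist b ++ twist 1 (-a))) :=
            (iso_twist_zero_halfTwist b _).append_left (carries_rationalWord _ _)
        Iso 0 _ ((rationalWord true l ++ halfTwist b) ++ twist 1 (-a)) := by
            simpa using Iso.refl _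
        Iso 0 _ (mirrorWord (rationalWord false l ++ twist 1 a)) := by
            simpa [mirror_twist] using (ih true).append_right (twist 1 (-a))
    · calc Iso 0 ((rationalWord false l ++ twist 1 a) ++ halfTwist b)
            (rationalWord false l ++ (twist 1 a ++ halfTwist b)) := by simpa using Iso.refl _
        Iso 0 _ (rationalWord false l ++ (halfTwist b ++ twist 0 a)) :=
            (iso_twist_one_halfTwist b _).append_left (carries_rationalWord _ _)
        Iso 0 _ ((rationalWord false l ++ halfTwist b) ++ twist 0 a) := by
            simpa using Iso.refl _
        Iso 0 _ (mirrorWord (rationalWord true l ++ twist 0 (-a))) := by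
            simpa [mirror_twist] using (ih false).append_right (twist 0 a)

/-- Nested maxima are parallel maxima below which a half twist has been inserted; the tangle then
absorbs the half twist. -/
theorem iso_rationalWord_caps (c : Bool) (l : List ℤ) :
    Iso 0 (rationalWord c l ++ [cap 1, cap 0]) (mirrorWord (rationalWord (!c) l ++ [cap 0, cap 0])) := by
  refine .trans ((iso_halfTwist_caps true).symm.append_left (carries_rationalWord c l)) ?_
  simpa using (iso_rationalWord_halfTwist true c l).append_right [cap 0, cap 0]

/-- One band between the middle strands makes the twists `a` trivial, which leaves the mirror image
of `C l`. -/
theorem UnknotsIn.C_cons {n : ℕ} {l : List ℤ} (a : ℤ) (h : UnknotsIn n (C l)) :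
    UnknotsIn (n + 1) (C (a :: l)) := by
  have hc : Carries 0 (rationalWord false l ++ twist 1 a) 4 := carries_rationalWord true (a :: l)
  have hE : Carries 0 ((rationalWord false l ++ twist 1 a) ++ [cap 1, cup 1, cap 0, cap 0]) 0 :=
    hc.append (by simp [carries_cons, carries_nil])
  refine .succ (E := ⟨_, hE⟩) (.refl _) (.inl ⟨rationalWord true (a :: l), [cap 0, cap 0], 1, rfl,
    by simp [rationalWord]⟩) (h.mirror.of_equivalent (equivalent_of_iso ?_))
  calc Iso 0 ((rationalWord false l ++ twist 1 a) ++ [cap 1, cup 1, cap 0, cap 0])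
        ((rationalWord false l ++ twist 1 a) ++ [cap 1, cap 0]) := by
        simpa using (iso_zigzagRight (m := 2) (i := 0) (by omega)).inside
          ((rationalWord false l ++ twist 1 a) ++ [cap 1]) [cap 0]
          (hc.append (carries_slice (P := .cap) (by simp)))
    Iso 0 _ (rationalWord false l ++ [cap 1, cap 0]) := by
        simpa using (iso_twist_cap a (m := 4) (i := 1) (by omega)).inside (rationalWord false l)
          [cap 0] (carries_rationalWord false l)
    Iso 0 _ (mirrorWord (rationalWord true l ++ [cap 0, cap 0])) := iso_rationalWord_caps false l

theorem u2_C_le (a : List ℤ) (k : ℕ) (hk : k ≤ a.length) : u2 (C a) ≤ u2 (C (a.drop k)) + k := by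
  refine u2_le_add k fun n hn => ?_
  induction k generalizing a with
  | zero => simpa using hn
  | succ k ih =>
    match a, hk, hn with
    | b :: l, hk, hn => exact (ih l (by simpa using hk) hn).C_cons b

/-! ### The normal form of a rational tangle -/

/-- The normal form of the rational tangle with fraction `p/q ≥ 0`, from the Euclidean
algorithm. -/
def normalForm : ℕ → ℕ → List Slice
  | p, q =>
    if q = 0 then nestedCups
    else if p = 0 then parallelCups
    else if q ≤ p then normalForm (p - q) q ++ [pos 1]
    else normalForm p (q - p) ++ [neg 0]
termination_by p q => p + q

theorem normalForm_zero_right (p : ℕ) : normalForm p 0 = nestedCups := by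
  rw [normalForm, if_pos rfl]

theorem normalForm_zero_left {q : ℕ} (hq : q ≠ 0) : normalForm 0 q = parallelCups := by
  rw [normalForm, if_neg hq, if_pos rfl]

theorem normalForm_add_left (p : ℕ) {q : ℕ} (hq : q ≠ 0) :
    normalForm (p + q) q = normalForm p q ++ [pos 1] := by
  rw [normalForm, if_neg hq, if_neg (by omega), if_pos (by omega), Nat.add_sub_cancel]

theorem normalForm_add_right {p q : ℕ} (hp : p ≠ 0) (hq : q ≠ 0) :
    normalForm p (q + p) = normalForm p q ++ [neg 0] := by
  rw [normalForm, if_neg (by omega), if_neg hp, if_neg (by omega), Nat.add_sub_cancel]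

theorem carries_normalForm (p q : ℕ) : Carries 0 (normalForm p q) 4 := by
  induction p, q using normalForm.induct with
  | case1 p => rw [normalForm_zero_right]; exact carries_cups (by omega)
  | case2 q hq => rw [normalForm_zero_left hq]; exact carries_cups (by omega)
  | case3 p q hq hp h ih =>
    obtain ⟨r, rfl⟩ := Nat.exists_eq_add_of_le' h
    rw [normalForm_add_left r hq]
    rw [Nat.add_sub_cancel] at ih
    exact ih.append (carries_crossing true (by omega))
  | case4 p q hq hp h ih =>
    obtain ⟨r, rfl⟩ := Nat.exists_eq_add_of_le' (le_of_not_ge h)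
    rw [normalForm_add_right hp (by omega)]
    rw [Nat.add_sub_cancel] at ih
    exact ih.append (carries_crossing false (by omega))

theorem iso_nestedCups_one (b : Bool) : Iso 0 (nestedCups ++ [crossing b 1]) nestedCups :=
  (iso_reidemeister1_cup (m := 2) b (by omega)).append_left (u := [cup 0])
    (carries_slice (P := .cup) le_rfl)

theorem iso_parallelCups_zero (b : Bool) : Iso 0 (parallelCups ++ [crossing b 0]) parallelCups :=
  (iso_reidemeister1_cup (m := 2) b (by omega)).append_left (u := [cup 0])
    (carries_slice (P := .cup) le_rfl)

theorem iso_normalForm_pos (p q : ℕ) :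
    Iso 0 (normalForm p q ++ [pos 1]) (normalForm (p + q) q) := by
  rcases eq_or_ne q 0 with rfl | hq
  · rw [normalForm_zero_right, normalForm_zero_right]
    exact iso_nestedCups_one true
  · rw [normalForm_add_left p hq]

/-- The pair (0, 0) must be excluded: its normal form is the nested one, which a crossing on the
left changes. -/
theorem iso_normalForm_neg {p q : ℕ} (h : p ≠ 0 ∨ q ≠ 0) :
    Iso 0 (normalForm p q ++ [neg 0]) (normalForm p (q + p)) := by
  rcases eq_or_ne p 0 with rfl | hp
  · have hq : q ≠ 0 := by simpa using h
    rw [add_zero, normalForm_zero_left hq]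
    exact iso_parallelCups_zero false
  rcases eq_or_ne q 0 with rfl | hq
  -- At equal entries the Euclidean algorithm prefers a middle crossing, so the left crossing on
  -- nested arcs has to be converted into one.
  · have := normalForm_add_left 0 hp
    rw [normalForm_zero_left hp, zero_add] at this
    rw [normalForm_zero_right, zero_add, this]
    exact iso_nestedCups_crossing false
  · rw [normalForm_add_right hp hq]

/-- The half twist acts on fractions as x ↦ -1/x: it interchanges the two kinds of Euclidean steps
and the two trivial tangles. -/
theorem iso_mirror_normalForm_halfTwist (b : Bool) {p q : ℕ} (h : p ≠ 0 ∨ q ≠ 0) :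
    Iso 0 (mirrorWord (normalForm p q) ++ halfTwist b) (normalForm q p) := by
  induction p, q using normalForm.induct with
  | case1 p =>
    rw [normalForm_zero_right, normalForm_zero_left (by simpa using h)]
    exact iso_nestedCups_halfTwist b
  | case2 q hq =>
    rw [normalForm_zero_right, normalForm_zero_left hq]
    exact iso_parallelCups_halfTwist b
  | case3 p q hq hp h' ih =>
    obtain ⟨r, rfl⟩ := Nat.exists_eq_add_of_le' h'
    rw [normalForm_add_left r hq]
    rw [Nat.add_sub_cancel] at ih
    calc Iso 0 (mirrorWord (normalForm r q ++ [pos 1]) ++ halfTwist b)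
          (mirrorWord (normalForm r q) ++ ([crossing false 1] ++ halfTwist b)) := by
          simpa using Iso.refl _
      Iso 0 _ (mirrorWord (normalForm r q) ++ (halfTwist b ++ [crossing false 0])) :=
          (iso_crossing_one_halfTwist b false).append_left (carries_normalForm r q).mirror
      Iso 0 _ (normalForm q r ++ [neg 0]) := by
          simpa using (ih (.inr hq)).append_right [neg 0]
      Iso 0 _ (normalForm q (r + q)) := iso_normalForm_neg (.inl hq)
  | case4 p q hq hp h' ih =>
    obtain ⟨r, rfl⟩ := Nat.exists_eq_add_of_le' (le_of_not_ge h')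
    rw [normalForm_add_right hp (by omega)]
    rw [Nat.add_sub_cancel] at ih
    calc Iso 0 (mirrorWord (normalForm p r ++ [neg 0]) ++ halfTwist b)
          (mirrorWord (normalForm p r) ++ ([crossing true 0] ++ halfTwist b)) := by
          simpa using Iso.refl _
      Iso 0 _ (mirrorWord (normalForm p r) ++ (halfTwist b ++ [crossing true 1])) :=
          (iso_crossing_zero_halfTwist b true).append_left (carries_normalForm p r).mirror
      Iso 0 _ (normalForm r p ++ [pos 1]) := by
          simpa using (ih (.inl hp)).append_right [pos 1]
      Iso 0 _ (normalForm (r + p) p) := iso_normalForm_pos r p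

/-- The normal form of the rational tangle with fraction `p/q`. -/
def intNormalForm (p q : ℤ) : List Slice :=
  -- If the product is 0, the normal form has no crossings and is its own mirror image.
  if 0 ≤ p * q then normalForm p.natAbs q.natAbs else mirrorWord (normalForm p.natAbs q.natAbs)

theorem intNormalForm_neg_neg (p q : ℤ) : intNormalForm (-p) (-q) = intNormalForm p q := by
  simp [intNormalForm]

theorem intNormalForm_natCast (p q : ℕ) : intNormalForm p q = normalForm p q := by
  rw [intNormalForm, if_pos (by positivity)]
  simp

theorem intNormalForm_neg_left (p q : ℕ) :
    intNormalForm (-p) q = mirrorWord (normalForm p q) := by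
  rcases eq_or_ne q 0 with rfl | hq
  · simp [intNormalForm, normalForm_zero_right]
  rcases eq_or_ne p 0 with rfl | hp
  · simp [intNormalForm, normalForm_zero_left hq]
  rw [intNormalForm, if_neg]
  · simp
  · have : (0 : ℤ) < p * q := by positivity
    simpa using this

theorem intNormalForm_neg_right (p q : ℕ) :
    intNormalForm p (-q) = mirrorWord (normalForm p q) := by
  rw [← intNormalForm_neg_left, ← intNormalForm_neg_neg, neg_neg]

theorem carries_intNormalForm (p q : ℤ) : Carries 0 (intNormalForm p q) 4 := by
  unfold intNormalForm
  split_ifs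
  · exact carries_normalForm _ _
  · exact (carries_normalForm _ _).mirror

theorem Iso.cancel_crossing {m n i : ℕ} {x y : List Slice} {b : Bool} (hx : Carries m x n)
    (hi : i + 2 ≤ n) (h : Iso m (x ++ [crossing b i]) y) : Iso m x (y ++ [crossing (!b) i]) := by
  refine .trans ?_ (h.append_right _)
  simpa using (iso_reidemeister2 b hi).symm.append_left hx

/-- For a negative fraction -r/q with q ≤ r, the crossing undoes a Euclidean step. For r < q the
fraction changes sign, and this requires the half twist. -/
theorem iso_intNormalForm_natCast_pos (p : ℤ) (q : ℕ) :
    Iso 0 (intNormalForm p q ++ [pos 1]) (intNormalForm (p + q) q) := by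
  obtain ⟨r, rfl | rfl⟩ := p.eq_nat_or_neg
  · rw [← Nat.cast_add, intNormalForm_natCast, intNormalForm_natCast]
    exact iso_normalForm_pos r q
  rw [intNormalForm_neg_left]
  rcases le_or_gt q r with h | h
  · obtain ⟨s, rfl⟩ := Nat.exists_eq_add_of_le' h
    rw [show -((s + q : ℕ) : ℤ) + q = -s by push_cast; ring, intNormalForm_neg_left]
    have h1 : Iso 0 (mirrorWord (normalForm s q) ++ [crossing false 1])
        (mirrorWord (normalForm (s + q) q)) := by
      simpa using (iso_normalForm_pos s q).mirror
    exact (h1.cancel_crossing (carries_normalForm s q).mirror (by omega)).symm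
  · obtain ⟨s, rfl⟩ := Nat.exists_eq_add_of_lt h
    set t := s + 1 with ht
    have e : r + s + 1 = t + r := by omega
    rw [e, show -(r : ℤ) + ((t + r : ℕ) : ℤ) = t by push_cast; ring, intNormalForm_natCast]
    have ht0 : t ≠ 0 := by omega
    have h1 : Iso 0 (mirrorWord (normalForm r t) ++ [pos 0]) (mirrorWord (normalForm r (t + r))) := by
      simpa using (iso_normalForm_neg (.inr ht0)).mirror
    have h2 : Iso 0 ((mirrorWord (normalForm r t) ++ [pos 0, pos 1]) ++ [crossing true 0])
        (normalForm t r) := by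
      simpa [halfTwist] using iso_mirror_normalForm_halfTwist true (p := r) (q := t) (.inr ht0)
    have hc : Carries 0 (mirrorWord (normalForm r t) ++ [pos 0, pos 1]) 4 :=
      (carries_normalForm r t).mirror.append ((carries_crossing true (i := 0) (by omega)).append
        (carries_crossing true (i := 1) (by omega)))
    -- The last step of -r/(t + r) and the new crossing form a half twist short of one crossing. The
    -- full half twist turns -r/t into t/r, and the correcting crossing then gives t/(r + t).
    calc Iso 0 (mirrorWord (normalForm r (t + r)) ++ [pos 1])
          (mirrorWord (normalForm r t) ++ [pos 0, pos 1]) := by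
          simpa using h1.symm.append_right [pos 1]
      Iso 0 _ (normalForm t r ++ [neg 0]) := h2.cancel_crossing hc (by omega)
      Iso 0 _ (normalForm t (r + t)) := iso_normalForm_neg (.inl ht0)
      Iso 0 _ (normalForm t (t + r)) := by rw [add_comm]

theorem iso_natCast_intNormalForm_neg (p : ℕ) (q : ℤ) (h : p ≠ 0 ∨ q ≠ 0) :
    Iso 0 (intNormalForm p q ++ [neg 0]) (intNormalForm p (q + p)) := by
  obtain ⟨r, rfl | rfl⟩ := q.eq_nat_or_neg
  · rw [← Nat.cast_add, intNormalForm_natCast, intNormalForm_natCast]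
    exact iso_normalForm_neg (by simpa using h)
  have h : p ≠ 0 ∨ r ≠ 0 := by simpa using h
  rw [intNormalForm_neg_right]
  rcases le_or_gt p r with h' | h'
  · obtain ⟨s, rfl⟩ := Nat.exists_eq_add_of_le' h'
    rw [show -((s + p : ℕ) : ℤ) + p = -s by push_cast; ring, intNormalForm_neg_right]
    have h1 : Iso 0 (mirrorWord (normalForm p s) ++ [crossing true 0])
        (mirrorWord (normalForm p (s + p))) := by
      simpa using (iso_normalForm_neg (p := p) (q := s) (by omega)).mirror
    exact (h1.cancel_crossing (carries_normalForm p s).mirror (by omega)).symm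
  · obtain ⟨s, rfl⟩ := Nat.exists_eq_add_of_lt h'
    set t := s + 1 with ht
    have e : r + s + 1 = t + r := by omega
    rw [e, show -(r : ℤ) + ((t + r : ℕ) : ℤ) = t by push_cast; ring, intNormalForm_natCast]
    have ht0 : t ≠ 0 := by omega
    have h1 : Iso 0 (mirrorWord (normalForm t r) ++ [neg 1]) (mirrorWord (normalForm (t + r) r)) := by
      simpa using (iso_normalForm_pos t r).mirror
    -- Here the incomplete half twist lacks a middle crossing, so the other side of Reidemeister III
    -- is used.
    have r3 : Iso 4 [neg 1, neg 0, neg 1] (halfTwist false) :=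
      iso_reidemeister3 false false (m := 4) (i := 0) (by omega)
    have h2 : Iso 0 ((mirrorWord (normalForm t r) ++ [neg 1, neg 0]) ++ [crossing false 1])
        (normalForm r t) := by
      refine .trans ?_ (iso_mirror_normalForm_halfTwist false (p := t) (q := r) (.inl ht0))
      simpa using r3.append_left (carries_normalForm t r).mirror
    have hc : Carries 0 (mirrorWord (normalForm t r) ++ [neg 1, neg 0]) 4 :=
      (carries_normalForm t r).mirror.append ((carries_crossing false (i := 1) (by omega)).append
        (carries_crossing false (i := 0) (by omega)))
    calc Iso 0 (mirrorWord (normalForm (t + r) r) ++ [neg 0])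
          (mirrorWord (normalForm t r) ++ [neg 1, neg 0]) := by
          simpa using h1.symm.append_right [neg 0]
      Iso 0 _ (normalForm r t ++ [pos 1]) := h2.cancel_crossing hc (by omega)
      Iso 0 _ (normalForm (r + t) t) := iso_normalForm_pos r t
      Iso 0 _ (normalForm (t + r) t) := by rw [add_comm]

theorem iso_intNormalForm_pos (p q : ℤ) :
    Iso 0 (intNormalForm p q ++ [pos 1]) (intNormalForm (p + q) q) := by
  obtain ⟨r, rfl | rfl⟩ := q.eq_nat_or_neg
  · exact iso_intNormalForm_natCast_pos p r
  · rw [← intNormalForm_neg_neg, ← intNormalForm_neg_neg (p + _), neg_add, neg_neg]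
    exact iso_intNormalForm_natCast_pos (-p) r

theorem iso_intNormalForm_neg {p q : ℤ} (h : p ≠ 0 ∨ q ≠ 0) :
    Iso 0 (intNormalForm p q ++ [neg 0]) (intNormalForm p (q + p)) := by
  obtain ⟨r, rfl | rfl⟩ := p.eq_nat_or_neg
  · exact iso_natCast_intNormalForm_neg r q (by simpa using h)
  · rw [← intNormalForm_neg_neg, ← intNormalForm_neg_neg _ (q + _), neg_add, neg_neg]
    exact iso_natCast_intNormalForm_neg r (-q) (by simpa using h)

theorem iso_intNormalForm_twist_one (p q a : ℤ) :
    Iso 0 (intNormalForm p q ++ twist 1 a) (intNormalForm (a * q + p) q) := by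
  have key : ∀ (b : Bool) (n : ℕ) (p : ℤ), Iso 0
      (intNormalForm p q ++ List.replicate n (crossing b 1))
      (intNormalForm ((if b then (n : ℤ) else -n) * q + p) q) := by
    intro b n
    induction n with
    | zero => intro p; simpa using Iso.refl _
    | succ n ih =>
      intro p
      have h1 : Iso 0 (intNormalForm p q ++ [crossing b 1])
          (intNormalForm (p + if b then q else -q) q) := by
        cases b
        · have := (iso_intNormalForm_pos (p - q) q).cancel_crossing (b := true)
            (carries_intNormalForm _ _) (by omega)
          simpa [sub_eq_add_neg] using this.symm
        · exact iso_intNormalForm_pos p q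
      have h2 := (h1.append_right (List.replicate n (crossing b 1))).trans (ih _)
      have e : (if b then (n : ℤ) else -n) * q + (p + if b then q else -q) =
          (if b then ((n + 1 : ℕ) : ℤ) else -((n + 1 : ℕ) : ℤ)) * q + p := by
        cases b <;> push_cast <;> simp <;> ring
      rw [e] at h2
      simpa [List.replicate_succ] using h2
  rw [twist_eq]
  have := key (decide (0 ≤ a)) a.natAbs p
  rwa [show (if decide (0 ≤ a) = true then (a.natAbs : ℤ) else -a.natAbs) = a by
    split_ifs with h <;> simp at h <;> omega] at this

theorem iso_intNormalForm_twist_zero {p q : ℤ} (h : p ≠ 0 ∨ q ≠ 0) (a : ℤ) :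
    Iso 0 (intNormalForm p q ++ twist 0 (-a)) (intNormalForm p (a * p + q)) := by
  have key : ∀ (b : Bool) (n : ℕ) (q : ℤ), (p ≠ 0 ∨ q ≠ 0) → Iso 0
      (intNormalForm p q ++ List.replicate n (crossing b 0))
      (intNormalForm p ((if b then -(n : ℤ) else n) * p + q)) := by
    intro b n
    induction n with
    | zero => intro q _; simpa using Iso.refl _
    | succ n ih =>
      intro q h
      -- The step on the pair is invertible, so it never produces (0, 0).
      have h0 : p ≠ 0 ∨ q + (if b then -p else p) ≠ 0 := by
        by_cases hp : p = 0
        · subst hp; simpa using h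
        · exact .inl hp
      have h1 : Iso 0 (intNormalForm p q ++ [crossing b 0])
          (intNormalForm p (q + if b then -p else p)) := by
        cases b
        · exact iso_intNormalForm_neg h
        · have := (iso_intNormalForm_neg h0).cancel_crossing (b := false)
            (carries_intNormalForm _ _) (by omega)
          simpa using this.symm
      have h2 := (h1.append_right (List.replicate n (crossing b 0))).trans (ih _ h0)
      have e : (if b then -(n : ℤ) else n) * p + (q + if b then -p else p) =
          (if b then -((n + 1 : ℕ) : ℤ) else ((n + 1 : ℕ) : ℤ)) * p + q := by
        cases b <;> simp <;> ring
      rw [e] at h2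
      simpa [List.replicate_succ] using h2
  rw [twist_eq]
  have := key (decide (0 ≤ -a)) (-a).natAbs q h
  rwa [show (if decide (0 ≤ -a) = true then -((-a).natAbs : ℤ) else (-a).natAbs) = a by
    split_ifs with h <;> simp at h <;> omega] at this

theorem isCoprime_contFrac (l : List ℤ) : IsCoprime (contFrac l).1 (contFrac l).2 := by
  induction l with
  | nil => exact isCoprime_one_left
  | cons a l ih =>
    obtain ⟨x, y, h⟩ := ih
    refine ⟨y, x - a * y, ?_⟩
    change y * (a * (contFrac l).1 + (contFrac l).2) + (x - a * y) * (contFrac l).1 = 1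
    linear_combination h

/-- Hence the fraction determines the rational tangle up to isotopy. Interchanging the two twisting
positions inverts the fraction. -/
theorem iso_rationalWord_intNormalForm (l : List ℤ) :
    Iso 0 (rationalWord true l) (intNormalForm (contFrac l).1 (contFrac l).2) ∧
    Iso 0 (rationalWord false l) (intNormalForm (contFrac l).2 (contFrac l).1) := by
  induction l with
  | nil =>
    have h1 := intNormalForm_natCast 1 0
    have h2 := intNormalForm_natCast 0 1
    rw [normalForm_zero_right] at h1
    rw [normalForm_zero_left one_ne_zero] at h2
    constructor
    · exact h1 ▸ Iso.refl _
    · exact h2 ▸ Iso.refl _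
  | cons a l ih =>
    constructor
    · exact (ih.2.append_right (twist 1 a)).trans (iso_intNormalForm_twist_one _ _ a)
    · exact (ih.1.append_right (twist 0 (-a))).trans
        (iso_intNormalForm_twist_zero (isCoprime_contFrac l).ne_zero_or_ne_zero a)

/-- Coprime pairs with the same ratio agree up to a common sign, which the normal form does not see.
-/
theorem IsContFrac.intNormalForm_eq {p q : ℤ} {a : List ℤ} (h : IsContFrac p q a) :
    intNormalForm p q = intNormalForm (contFrac a).1 (contFrac a).2 ∧
    intNormalForm q p = intNormalForm (contFrac a).2 (contFrac a).1 := by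
  obtain ⟨-, hpq, e⟩ := h
  have hc := isCoprime_contFrac a
  generalize (contFrac a).1 = c at *
  generalize (contFrac a).2 = d at *
  have h1 : p.natAbs = c.natAbs := Int.natAbs_eq_of_dvd_dvd
    (hpq.dvd_of_dvd_mul_left ⟨d, e.symm⟩) (hc.dvd_of_dvd_mul_right ⟨q, by linarith⟩)
  have h2 : q.natAbs = d.natAbs := Int.natAbs_eq_of_dvd_dvd
    (hpq.symm.dvd_of_dvd_mul_left ⟨c, e⟩) (hc.symm.dvd_of_dvd_mul_right ⟨p, by linarith⟩)
  have h3 : p * q = c * d := by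
    rcases Int.natAbs_eq_natAbs_iff.1 h1 with rfl | rfl <;>
      rcases Int.natAbs_eq_natAbs_iff.1 h2 with rfl | rfl <;> linarith
  constructor
  · rw [intNormalForm, intNormalForm, h1, h2, h3]
  · rw [intNormalForm, intNormalForm, h1, h2, mul_comm q, mul_comm d, h3]

/-! ### Tangle unknotting number one links -/

theorem UnknotsIn.of_isTangleUnknottingNumberOne {p q : ℤ} {K L : LinkDiagram} {n : ℕ}
    (hK : IsTangleUnknottingNumberOne p q K) (hL : IsTwoBridge q p L) (h : UnknotsIn n L) :
    UnknotsIn (n + 1) K := by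
  obtain ⟨a, T, ha, hKT, hT⟩ := hK
  obtain ⟨b, hb, hLb⟩ := hL
  have h1 : UnknotsIn n (C b) := h.of_equivalent (hLb.symm _ _)
  have hA : Carries 0 (rationalWord true a ++ [cap 1]) 2 :=
    (carries_rationalWord true a).append (carries_slice (P := .cap) (by simp))
  have hE : Carries 0 ((rationalWord true a ++ [cap 1]) ++ ([cup 1] ++ T.word)) 0 :=
    hA.append ((carries_slice (P := .cup) (by simp)).append T.carries)
  -- The band makes a connected sum: below it the arc given by T₁ and a middle maximum, above it the
  -- rest, which the bottom minimum of T₀ completes to T₀ ∪ T₂.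
  refine .succ (E := ⟨_, hE⟩) hKT (.inl ⟨rationalWord true a, T.word, 1, rfl, by simp⟩)
    (h1.mirror.of_equivalent (equivalent_of_iso ?_))
  -- Both tangles have fraction q/p.
  have h2 : Iso 0 (rationalWord false a) (rationalWord true b) := by
    refine (iso_rationalWord_intNormalForm a).2.trans ?_
    rw [← ha.intNormalForm_eq.2, hb.intNormalForm_eq.1]
    exact (iso_rationalWord_intNormalForm b).1.symm
  calc Iso 0 ((rationalWord true a ++ [cap 1]) ++ ([cup 1] ++ T.word))
        ((rationalWord true a ++ [cap 1]) ++ [cap 0]) := iso_of_closure_unknot hA hT.iso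
    Iso 0 _ (mirrorWord (rationalWord false a ++ [cap 0, cap 0])) := by
        simpa using iso_rationalWord_caps true a
    Iso 0 _ (mirrorWord (rationalWord true b ++ [cap 0, cap 0])) := (h2.append_right _).mirror

end H2Unknotting

theorem mainTheorem5 :
    (∀ (p q : ℤ) (K L : H2Unknotting.LinkDiagram),
      H2Unknotting.IsTangleUnknottingNumberOne p q K → H2Unknotting.IsTwoBridge q p L →
        H2Unknotting.u2 K ≤ H2Unknotting.u2 L + 1) ∧
    (∀ (a : List ℤ) (i : ℕ), 1 ≤ i → i ≤ a.length →
      H2Unknotting.u2 (H2Unknotting.C a) ≤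
        H2Unknotting.u2 (H2Unknotting.C (a.drop (i - 1))) + ((i - 1 : ℕ) : ℕ∞)) :=
  ⟨fun _ _ _ _ hK hL => by
      exact_mod_cast H2Unknotting.u2_le_add 1 fun _ h => h.of_isTangleUnknottingNumberOne hK hL,
    fun a i _ hi => H2Unknotting.u2_C_le a (i - 1) (by omega)⟩
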